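/- Let $G$ be a finite abelian group, written additively, $\hat G=\mathrm{Hom}(G,\mathbb{Q}/\mathbb{Z})$, $n\in\mathbb{N}$, and let $E$ be a CW complex with oriented cells. Write $\mathcal{E}_i$ for the set of $i$-cells (so $\mathcal{E}_{-1}=\emptyset$) and $d_{\alpha\beta}\in\mathbb{Z}$ ($\alpha\in\mathcal{E}_{i+1}$, $\beta\in\mathcal{E}_i$) for the cellular incidence numbers, i.e. the coefficients of the cellular boundary $H_{i+1}(E^{i+1},E^{i};\mathbb{Z})\to H_i(E^i,E^{i-1};\mathbb{Z})$ in the bases given by the oriented cells (the degrees of the maps $S^i\to E^i\to E^i/(E^i\setminus e_\beta)\simeq S^i$). Assume that for every cell $\beta$ the set $\{\alpha\mid d_{\alpha\beta}\ne0\}$ is finite. A locally finite $i$-chain is an arbitrary family $(\chi_\alpha)_{\alpha\in\mathcal{E}_i}$ in $\hat G$ and an $i$-cochain an arbitrary family $(g_\alpha)_{\alpha\in\mathcal{E}_i}$ in $G$, also written $\sum_\alpha\chi_\alpha e_\alpha$ and $\sum_\alpha g_\alpha e_\alpha$; $i$-chains and locally finite $i$-cochains are those with finite support. Put $\partial(\sum_\alpha\chi_\alpha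 e_\alpha)=\sum_\beta(\sum_\alpha d_{\alpha\beta}\chi_\alpha)e_\beta$ and $\partial^T(\sum_\beta g_\beta e_\beta)=\sum_\alpha(\sum_\beta d_{\alpha\beta}g_\beta)e_\alpha$. An $n$-cycle is an $n$-chain $b$ with $\partial b=0$ and a locally finite $n$-cocycle is a locally finite $n$-cochain $a$ with $\partial^Ta=0$. The pairing is $\langle\sum_\alpha\chi_\alpha e_\alpha,\sum_\alpha g_\alpha e_\alpha\rangle=\sum_\alpha\chi_\alpha(g_\alpha)\in\mathbb{Q}/\mathbb{Z}$ whenever one of the two has finite support. Let $\mathfrak{A}$ be the quasi-local C*-algebra with site set $\mathcal{E}_n$ and Hilbert space $\ell^2(G)$ at every site. For finitely supported $a=\sum_\alpha g_\alpha e_\alpha$ and $b=\sum_\alpha\chi_\alpha e_\alpha$ of degree $n$ let $X^a,Z^b\in\mathfrak{A}$ be the products over the sites of the operators $X^{g_\alpha}|h\rangle=|g_\alpha+h\rangle$ and $Z^{\chi_\alpha}|h\rangle=e^{2\pi i\chi_\alpha(h)}|h\rangle$. The interaction terms are $-A_\alpha$ ($\alpha\in\mathcal{E}_{n-1}$) and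 $-B_\beta$ ($\beta\in\mathcal{E}_{n+1}$), where the projections $A_\alpha,B_\beta$ are $A_\alpha=\frac1{|G|}\sum_{g\in G}X^{\partial^T(ge_\alpha)}$ and $B_\beta=\frac1{|G|}\sum_{\chi\in\hat G}Z^{\partial(\chi e_\beta)}$. A frustration-free ground state is a state $\omega_0$ on $\mathfrak{A}$ with $\omega_0(A_\alpha)=1$ and $\omega_0(B_\beta)=1$ for all $\alpha\in\mathcal{E}_{n-1}$, $\beta\in\mathcal{E}_{n+1}$. For a locally finite $n$-chain $\gamma$ and an $n$-cochain $\delta$ with restrictions $\gamma_K,\delta_K$ to finite $K\subseteq\mathcal{E}_n$, put $\rho_\gamma(A)=\lim_KZ^{\gamma_K}AZ^{-\gamma_K}$, $\rho_\delta(A)=\lim_KX^{\delta_K}AX^{-\delta_K}$ (norm limits over the directed set of finite subsets $K\subseteq\mathcal{E}_n$) and $\rho_{(\gamma,\delta)}=\rho_\gamma\circ\rho_\delta$. Then for all locally finite $n$-chains $\gamma,\gamma'$ and all $n$-cochains $\delta,\delta'$ the following are equivalent: (1) $\langle b,\delta'-\delta\rangle=0$ for every $n$-cycle $b$, and $\langle\gamma'-\gamma,a\rangle=0$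 for every locally finite $n$-cocycle $a$. (2) $\omega_0\circ\rho_{(\gamma,\delta)}=\omega_0\circ\rho_{(\gamma',\delta')}$ for every frustration-free ground state $\omega_0$ on $\mathfrak{A}$. -/

import Mathlib

open Topology CategoryTheory
open scoped ComplexOrder

universe u v

noncomputable section

/-! ## Relative singular homology -/

namespace CellModel

section Singular

variable (X : Type u) [TopologicalSpace X]

/-- The singular chain complex of `X` with integer coefficients. -/
def singularChains : ChainComplex (AddCommGrpCat.{u}) ℕ :=
  ((AlgebraicTopology.singularChainComplexFunctor (AddCommGrpCat.{u})).obj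
    (AddCommGrpCat.of (ULift.{u} ℤ))).obj (TopCat.of X)

variable {X} {Y : Type u} [TopologicalSpace Y]

/-- The chain map on singular chains induced by a continuous map. -/
def singularMap (f : C(X, Y)) : singularChains X ⟶ singularChains Y :=
  ((AlgebraicTopology.singularChainComplexFunctor (AddCommGrpCat.{u})).obj
    (AddCommGrpCat.of (ULift.{u} ℤ))).map (TopCat.ofHom f)

/-- The boundary map `S_p(X) → S_q(X)`; it is zero unless `p = q + 1`. -/
def singularD (X : Type u) [TopologicalSpace X] (p q : ℕ) :
    (singularChains X).X p →+ (singularChains X).X q :=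
  ((singularChains X).d p q).hom

/-- The map `S_p(X) → S_p(Y)` induced by a continuous map. -/
def singularPush (f : C(X, Y)) (p : ℕ) :
    (singularChains X).X p →+ (singularChains Y).X p :=
  ((singularMap f).f p).hom

/-- The inclusion of a subspace. -/
def inclusionMap (A : Set X) : C(A, X) := ⟨Subtype.val, continuous_subtype_val⟩

/-- The singular `p`-chains of `X` that lie in the subspace `A`. -/
def chainsIn (A : Set X) (p : ℕ) : AddSubgroup ((singularChains X).X p) :=
  AddMonoidHom.range (singularPush (inclusionMap A) p)

lemma singularD_comp (p q r : ℕ) (c : (singularChains X).X p) :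
    singularD X q r (singularD X p q c) = 0 := by
  have h := (singularChains X).d_comp_d p q r
  exact congrArg (fun f => f.hom c) h

lemma singularD_eq_zero {p q : ℕ} (h : q + 1 ≠ p) (c : (singularChains X).X p) :
    singularD X p q c = 0 := by
  have h := (singularChains X).shape p q (by simpa using h)
  exact congrArg (fun f => f.hom c) h

lemma singularD_push (f : C(X, Y)) (p q : ℕ) (c : (singularChains X).X p) :
    singularD Y p q (singularPush f p c) = singularPush f q (singularD X p q c) := by
  have h := (singularMap f).comm p q
  exact congrArg (fun f => f.hom c) h

lemma singularPush_comp {Z : Type u} [TopologicalSpace Z] (g : C(Y, Z)) (f : C(X, Y)) (p : ℕ)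
    (c : (singularChains X).X p) :
    singularPush g p (singularPush f p c) = singularPush (g.comp f) p c := by
  have h : singularMap (g.comp f) = singularMap f ≫ singularMap g := by
    unfold singularMap
    exact ((AlgebraicTopology.singularChainComplexFunctor (AddCommGrpCat.{u})).obj
      (AddCommGrpCat.of (ULift.{u} ℤ))).map_comp (TopCat.ofHom f) (TopCat.ofHom g)
  unfold singularPush
  rw [h]
  rfl

lemma singularPush_mem_chainsIn (f : C(X, Y)) {A : Set X} {B : Set Y} (h : Set.MapsTo f A B)
    (p : ℕ) {c : (singularChains X).X p} (hc : c ∈ chainsIn A p) :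
    singularPush f p c ∈ chainsIn B p := by
  obtain ⟨c, rfl⟩ := hc
  let f' : C(A, B) := ⟨fun x => ⟨f x, h x.2⟩, by fun_prop⟩
  refine ⟨singularPush f' p c, ?_⟩
  rw [singularPush_comp, singularPush_comp]
  rfl

lemma singularD_mem_chainsIn (A : Set X) (p q : ℕ) {c : (singularChains X).X p}
    (hc : c ∈ chainsIn A p) : singularD X p q c ∈ chainsIn A q := by
  obtain ⟨c, rfl⟩ := hc
  exact ⟨singularD A p q c, by rw [singularD_push]⟩

/-- The relative `p`-cycles of the pair `(A, B)`: singular chains in `A` with boundary in `B`. -/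
def relCycles (A B : Set X) (p : ℕ) : AddSubgroup ((singularChains X).X p) :=
  chainsIn A p ⊓ ⨅ q, (chainsIn B q).comap (singularD X p q)

/-- The relative `p`-boundaries of the pair `(A, B)`. -/
def relBoundaries (A B : Set X) (p : ℕ) : AddSubgroup ((singularChains X).X p) :=
  (chainsIn A (p + 1)).map (singularD X (p + 1) p) ⊔ chainsIn B p

/-- The relative singular homology group `H_p(A, B; ℤ)` of subspaces `B ⊆ A` of `X`. -/
abbrev RelHomology (A B : Set X) (p : ℕ) : Type u :=
  relCycles A B p ⧸ (relBoundaries A B p).addSubgroupOf (relCycles A B p)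

lemma mem_relCycles {A B : Set X} {p : ℕ} {c : (singularChains X).X p} :
    c ∈ relCycles A B p ↔ c ∈ chainsIn A p ∧ ∀ q, singularD X p q c ∈ chainsIn B q := by
  simp [relCycles]

lemma singularPush_mem_relCycles (f : C(X, Y)) {A B : Set X} {A' B' : Set Y}
    (hA : Set.MapsTo f A A') (hB : Set.MapsTo f B B') (p : ℕ) :
    Set.MapsTo (singularPush f p) (relCycles A B p) (relCycles A' B' p) := by
  intro c hc
  rw [SetLike.mem_coe, mem_relCycles] at hc ⊢
  refine ⟨singularPush_mem_chainsIn f hA p hc.1, fun q => ?_⟩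
  rw [singularD_push]
  exact singularPush_mem_chainsIn f hB q (hc.2 q)

/-- The map on relative homology induced by a continuous map of pairs. -/
def relMap (f : C(X, Y)) {A B : Set X} {A' B' : Set Y} (hA : Set.MapsTo f A A')
    (hB : Set.MapsTo f B B') (p : ℕ) : RelHomology A B p →+ RelHomology A' B' p :=
  QuotientAddGroup.map _ _
    ((singularPush f p).restrict (singularPush_mem_relCycles f hA hB p))
    (by
      rintro ⟨c, hc⟩ h
      simp only [AddSubgroup.mem_comap, AddSubgroup.mem_addSubgroupOf, relBoundaries,
        AddSubgroup.mem_sup, AddSubgroup.mem_map] at h ⊢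
      obtain ⟨_, ⟨x, hx, rfl⟩, y, hy, hxy⟩ := h
      refine ⟨_, ⟨singularPush f (p + 1) x, singularPush_mem_chainsIn f hA _ hx, rfl⟩,
        singularPush f p y, singularPush_mem_chainsIn f hB _ hy, ?_⟩
      rw [singularD_push, ← map_add, hxy]
      rfl)

end Singular

/-! ## Cellular chains of a CW complex -/

section Cellular

variable (E : Type u) [TopologicalSpace E] [T2Space E] [CWComplex (Set.univ : Set E)]

/-- The index set of the `p`-cells of `E`. -/
abbrev Cell (p : ℕ) : Type u := RelCWComplex.cell (Set.univ : Set E) p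

/-- The subspace `E^{p-1}`, i.e. the union of all cells of dimension less than `p`. -/
def skel (p : ℕ) : Set E := (RelCWComplex.skeletonLT (Set.univ : Set E) (p : ℕ∞) : Set E)

/-- The cellular chain group `H_p(E^p, E^{p-1}; ℤ)`. -/
abbrev CellularGroup (p : ℕ) : Type u := RelHomology (skel E (p + 1)) (skel E p) p

lemma singularD_mem_relCycles (p q : ℕ) :
    Set.MapsTo (singularD E p q) (relCycles (skel E (p + 1)) (skel E p) p)
      (relCycles (skel E (q + 1)) (skel E q) q) := by
  intro c hc
  rw [SetLike.mem_coe, mem_relCycles] at hc ⊢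
  refine ⟨?_, fun r => by rw [singularD_comp]; exact zero_mem _⟩
  by_cases h : q + 1 = p
  · subst h
    exact hc.2 q
  · rw [singularD_eq_zero h]
    exact zero_mem _

/-- The cellular boundary map `H_p(E^p, E^{p-1}) → H_q(E^q, E^{q-1})`, sending the class of a
relative cycle to the class of its boundary; it is zero unless `p = q + 1`. -/
def cellularBoundary (p q : ℕ) : CellularGroup E p →+ CellularGroup E q :=
  QuotientAddGroup.map _ _
    ((singularD E p q).restrict (singularD_mem_relCycles E p q))
    (by
      rintro ⟨c, hc⟩ h
      simp only [AddSubgroup.mem_comap, AddSubgroup.mem_addSubgroupOf, relBoundaries,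
        AddSubgroup.mem_sup, AddSubgroup.mem_map] at h ⊢
      obtain ⟨_, ⟨x, hx, rfl⟩, y, hy, hxy⟩ := h
      by_cases h : q + 1 = p
      · subst h
        refine ⟨singularD E (q + 1) q y, ⟨y, hy, rfl⟩, 0, zero_mem _, ?_⟩
        rw [add_zero]
        show _ = singularD E (q + 1) q c
        rw [← hxy, map_add, singularD_comp, zero_add]
      · refine ⟨0, ⟨0, zero_mem _, map_zero _⟩, 0, zero_mem _, ?_⟩
        rw [add_zero]
        exact (singularD_eq_zero h c).symm)

lemma cellularBoundary_eq_zero {p q : ℕ} (h : q + 1 ≠ p) (x : CellularGroup E p) :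
    cellularBoundary E p q x = 0 := by
  obtain ⟨⟨c, hc⟩, rfl⟩ := QuotientAddGroup.mk_surjective x
  refine (QuotientAddGroup.eq_zero_iff _).mpr ?_
  rw [AddSubgroup.mem_addSubgroupOf]
  show singularD E p q c ∈ relBoundaries _ _ _
  rw [singularD_eq_zero h]
  exact zero_mem _

/-- The closed `p`-ball (in the sup norm, i.e. a cube), lifted to the universe of `E`. -/
abbrev Ball (p : ℕ) : Type u := ULift.{u} (Metric.closedBall (0 : Fin p → ℝ) 1)

/-- The boundary sphere of the closed `p`-ball. -/
def ballBoundary (p : ℕ) : Set (Ball.{u} p) := {x | (x.down : Fin p → ℝ) ∈ Metric.sphere 0 1}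

/-- The characteristic map of a cell, as a continuous map on the closed ball. -/
def charMap {p : ℕ} (α : Cell E p) : C(Ball.{u} p, E) where
  toFun x := RelCWComplex.map (C := (Set.univ : Set E)) p α x.down
  continuous_toFun :=
    (continuousOn_iff_continuous_domRestrict.mp
      (RelCWComplex.continuousOn (C := (Set.univ : Set E)) p α)).comp continuous_uliftDown

lemma charMap_mapsTo {p : ℕ} (α : Cell E p) :
    Set.MapsTo (charMap E α) Set.univ (skel E (p + 1)) := by
  intro x _
  have h := RelCWComplex.closedCell_subset_skeletonLT (C := (Set.univ : Set E)) p α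
  have := h (Set.mem_image_of_mem _ x.down.2)
  unfold skel
  push_cast
  exact this

lemma charMap_mapsTo_boundary {p : ℕ} (α : Cell E p) :
    Set.MapsTo (charMap E α) (ballBoundary p) (skel E p) := by
  intro x hx
  exact RelCWComplex.cellFrontier_subset_skeletonLT (C := (Set.univ : Set E)) p α
    (Set.mem_image_of_mem _ hx)

/-- A choice of an orientation of every cell of `E`: a generator of the infinite cyclic group
`H_p(D^p, S^{p-1}; ℤ)` for every `p`-cell. -/
structure CellOrientation where
  gen : ∀ p : ℕ, Cell E p → RelHomology (Set.univ : Set (Ball.{u} p)) (ballBoundary p) p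
  generates : ∀ (p : ℕ) (α : Cell E p) (y : RelHomology (Set.univ : Set (Ball.{u} p))
    (ballBoundary p) p), ∃ k : ℤ, y = k • gen p α

end Cellular

namespace CellOrientation

variable {E : Type u} [TopologicalSpace E] [T2Space E] [CWComplex (Set.univ : Set E)]
  (o : CellOrientation E)

/-- The element of `H_p(E^p, E^{p-1})` represented by an oriented `p`-cell: the image of the
orientation under the characteristic map. -/
def cellClass (p : ℕ) (α : Cell E p) : CellularGroup E p :=
  relMap (charMap E α) (charMap_mapsTo E α) (charMap_mapsTo_boundary E α) p (o.gen p α)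

open Classical in
/-- The coordinates of an element of `H_q(E^q, E^{q-1})` with respect to the basis formed by the
classes of the oriented `q`-cells. (These classes always form a basis; the value `0` in the other
branch is never used.) -/
def cellCoord (q : ℕ) (x : CellularGroup E q) : Cell E q →₀ ℤ :=
  if h : LinearIndependent ℤ (o.cellClass q) ∧ ⊤ ≤ Submodule.span ℤ (Set.range (o.cellClass q)) then
    (Module.Basis.mk h.1 h.2).repr x
  else 0

/-- The incidence numbers `β ↦ d_{αβ}` of a `p`-cell `α` with the `q`-cells `β`: the coefficients
in `∂ e_α = ∑_β d_{αβ} e_β`. They are zero unless `p = q + 1`, and finitely many are nonzero. -/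
def incidence {p : ℕ} (q : ℕ) (α : Cell E p) : Cell E q →₀ ℤ :=
  o.cellCoord q (cellularBoundary E p q (o.cellClass p α))

lemma skel_mapsTo_compl {q : ℕ} (β : Cell E q) : Set.MapsTo (ContinuousMap.id E) (skel E q)
    (skel E (q + 1) \ RelCWComplex.openCell q β) := by
  intro x hx
  refine ⟨RelCWComplex.skeletonLT_mono (by norm_cast; omega) hx, fun h => ?_⟩
  exact Set.disjoint_left.mp
    (RelCWComplex.disjoint_skeletonLT_openCell (C := (Set.univ : Set E)) le_rfl) hx h

/-- The projection `H_q(E^q, E^{q-1}) → H_q(E^q, E^q ∖ e_β)`. The target is the reduced homology of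
the sphere obtained from `E^q` by collapsing the complement of the open cell `β`. -/
def collapse {q : ℕ} (β : Cell E q) : CellularGroup E q →+
    RelHomology (skel E (q + 1)) (skel E (q + 1) \ RelCWComplex.openCell q β) q :=
  relMap (ContinuousMap.id E) (Set.mapsTo_id _) (skel_mapsTo_compl β) q

lemma collapse_cellClass_of_ne {q : ℕ} {β β' : Cell E q} (h : β' ≠ β) :
    collapse β (o.cellClass q β') = 0 := by
  unfold cellClass
  obtain ⟨⟨c, hc⟩, hy⟩ := QuotientAddGroup.mk_surjective (o.gen q β')
  rw [← hy]
  refine (QuotientAddGroup.eq_zero_iff _).mpr ?_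
  rw [AddSubgroup.mem_addSubgroupOf]
  show singularPush (ContinuousMap.id E) q (singularPush (charMap E β') q c) ∈
    relBoundaries _ _ _
  rw [singularPush_comp]
  refine AddSubgroup.mem_sup_right (singularPush_mem_chainsIn _ (A := Set.univ) ?_ q
    (mem_relCycles.mp hc).1)
  intro x hx
  refine ⟨charMap_mapsTo E β' hx, fun hβ => ?_⟩
  have hx' : charMap E β' x ∈ RelCWComplex.closedCell (C := (Set.univ : Set E)) q β' :=
    Set.mem_image_of_mem _ x.down.2
  rw [← RelCWComplex.cellFrontier_union_openCell_eq_closedCell] at hx'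
  rcases hx' with hx' | hx'
  · exact Set.disjoint_left.mp
      (RelCWComplex.disjoint_skeletonLT_openCell (C := (Set.univ : Set E)) le_rfl)
      (RelCWComplex.cellFrontier_subset_skeletonLT (C := (Set.univ : Set E)) q β' hx') hβ
  · exact Set.disjoint_left.mp
      (RelCWComplex.disjoint_openCell_of_ne (C := (Set.univ : Set E)) (by simpa using h)) hx' hβ

/-- The incidence number `d_{αβ}` is the degree of the attaching sphere of `α` on the oriented
sphere obtained by collapsing the complement of `β`: the attaching sphere represents `d_{αβ}` times
the orientation class. -/
lemma collapse_boundary_eq_degree {p q : ℕ} (α : Cell E p) (β : Cell E q)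
    (h : LinearIndependent ℤ (o.cellClass q) ∧
      ⊤ ≤ Submodule.span ℤ (Set.range (o.cellClass q))) :
    collapse β (cellularBoundary E p q (o.cellClass p α)) =
      o.incidence q α β • collapse β (o.cellClass q β) := by
  classical
  set x := cellularBoundary E p q (o.cellClass p α) with hx
  have hinc : o.incidence q α = (Module.Basis.mk h.1 h.2).repr x := by
    rw [incidence, cellCoord, dif_pos h]
  have hsum := (Module.Basis.mk h.1 h.2).linearCombination_repr x
  rw [← hinc, Finsupp.linearCombination_apply, Finsupp.sum] at hsum
  rw [← hsum, map_sum]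
  simp only [map_zsmul, Module.Basis.mk_apply]
  refine (Finset.sum_eq_single β (fun β' _ hne => ?_) (fun hβ => ?_)).trans rfl
  · rw [o.collapse_cellClass_of_ne hne, smul_zero]
  · rw [Finsupp.notMem_support_iff.mp hβ]
    exact zero_zsmul _

lemma incidence_eq_zero {p q : ℕ} (h : q + 1 ≠ p) (α : Cell E p) : o.incidence q α = 0 := by
  unfold incidence cellCoord
  rw [cellularBoundary_eq_zero E h]
  split_ifs
  · exact map_zero _
  · rfl

/-- Every cell is incident to finitely many cells of the next dimension. -/
def LocallyFinite : Prop :=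
  ∀ (q : ℕ) (β : Cell E q), {α : Cell E (q + 1) | o.incidence q α β ≠ 0}.Finite

/-- The boundary `∂(∑ χ_α e_α) = ∑_β (∑_α d_{αβ} χ_α) e_β` of a finite `p`-chain with coefficients
in an abelian group, in degree `q` (zero unless `p = q + 1`). -/
def boundary {A : Type v} [AddCommGroup A] (p q : ℕ) (b : Cell E p →₀ A) : Cell E q →₀ A :=
  b.sum fun α χ => (o.incidence q α).mapRange (fun d : ℤ => d • χ) (zero_smul ℤ χ)

/-- The coboundary `∂ᵀ(∑ g_β e_β) = ∑_α (∑_β d_{αβ} g_β) e_α` of a (possibly infinite) `q`-cochain,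
in degree `p` (zero unless `p = q + 1`). -/
def coboundary {A : Type v} [AddCommGroup A] (q p : ℕ) (a : Cell E q → A) : Cell E p → A :=
  fun α => (o.incidence q α).sum fun β d => d • a β

/-- A finite `n`-chain is a cycle if its boundary, in degree `n - 1`, vanishes (a condition that
is empty for `n = 0`). -/
def IsCycle {A : Type v} [AddCommGroup A] (n : ℕ) (b : Cell E n →₀ A) : Prop :=
  ∀ m : ℕ, m + 1 = n → o.boundary n m b = 0

/-- A finite (that is, locally finite) `n`-cochain is a cocycle if its coboundary vanishes. -/
def IsLFCocycle {A : Type v} [AddCommGroup A] (n : ℕ) (a : Cell E n →₀ A) : Prop :=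
  o.coboundary n (n + 1) a = 0

lemma finite_support_coboundary_single (ho : o.LocallyFinite) {A : Type v} [AddCommGroup A]
    (q p : ℕ) (β : Cell E q) (g : A) :
    (Function.support (o.coboundary q p (Finsupp.single β g))).Finite := by
  by_cases h : q + 1 = p
  · subst h
    refine (ho q β).subset fun α hα h0 => hα ?_
    classical
    refine Finset.sum_eq_zero fun β' _ => ?_
    by_cases hb : β = β'
    · subst hb; simp [h0]
    · simp [hb]
  · convert Set.finite_empty
    ext α
    simp [coboundary, o.incidence_eq_zero h]

/-- The coboundary of `g e_β`, as a finite cochain. -/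
def coboundarySingle (ho : o.LocallyFinite) {A : Type v} [AddCommGroup A]
    (q p : ℕ) (β : Cell E q) (g : A) : Cell E p →₀ A :=
  Finsupp.ofSupportFinite _ (o.finite_support_coboundary_single ho q p β g)

end CellOrientation

/-! ## Characters and pairings -/

/-- The homomorphism `ℚ/ℤ → U(1)`, `t ↦ e^{2πit}`. -/
def expQZ : AddCircle (1 : ℚ) →+ Additive Circle :=
  QuotientAddGroup.lift (AddSubgroup.zmultiples (1 : ℚ))
    { toFun := fun q => Additive.ofMul (Circle.exp (2 * Real.pi * (q : ℝ)))
      map_zero' := by simp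
      map_add' := fun q r => by
        rw [← ofMul_mul, ← Circle.exp_add]
        congr 2
        push_cast
        ring }
    (by
      intro q hq
      obtain ⟨k, rfl⟩ := AddSubgroup.mem_zmultiples_iff.mp hq
      have : Circle.exp (2 * Real.pi * (k : ℝ)) = 1 := by
        rw [Circle.exp_eq_one]
        exact ⟨k, by ring⟩
      simpa using this)

/-- The phase `e^{2πit}` of `t ∈ ℚ/ℤ`. -/
def phase (t : AddCircle (1 : ℚ)) : Circle := (expQZ t).toMul

instance finite_characterModule (G : Type v) [AddCommGroup G] [Finite G] :
    Finite (CharacterModule G) := by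
  have hn : 0 < Nat.card G := Nat.card_pos
  have hfin := AddCircle.finite_torsion (1 : ℚ) hn
  have : Finite {t : AddCircle (1 : ℚ) | Nat.card G • t = 0} := hfin
  let f : CharacterModule G → G → {t : AddCircle (1 : ℚ) | Nat.card G • t = 0} :=
    fun χ g => ⟨χ g, by
      show Nat.card G • χ g = 0
      rw [← map_nsmul, card_nsmul_eq_zero', map_zero]⟩
  refine Finite.of_injective f fun χ ψ h => ?_
  refine DFunLike.ext _ _ fun g => ?_
  exact congrArg Subtype.val (congrFun h g)

instance fintype_characterModule (G : Type v) [AddCommGroup G] [Finite G] :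
    Fintype (CharacterModule G) := Fintype.ofFinite _

section Pairing

variable {S : Type u} {G : Type v} [AddCommGroup G]

/-- The pairing `⟨b, δ⟩ = ∑_α b_α(δ_α)` of a finite chain with an arbitrary cochain. -/
def pairChain (b : S →₀ CharacterModule G) (δ : S → G) : AddCircle (1 : ℚ) :=
  b.sum fun α χ => χ (δ α)

/-- The pairing `⟨γ, a⟩ = ∑_α γ_α(a_α)` of an arbitrary chain with a finite cochain. -/
def pairLF (γ : S → CharacterModule G) (a : S →₀ G) : AddCircle (1 : ℚ) :=
  a.sum fun α g => γ α g

end Pairing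

/-! ## The quasi-local algebra

The sites are the elements of a set `S`, with Hilbert space `ℓ²(G)` at each site. The algebra is
realised on the Hilbert space with orthonormal basis `|h⟩` indexed by the finitely supported
configurations `h : S →₀ G`. On it `B(ℓ²(G)^{⊗Λ})` acts faithfully (as `A ⊗ 1`) for every finite
`Λ ⊆ S`, compatibly with the inclusions `A ↦ A ⊗ 1`, so that the norm closure of the union of
these algebras is the C⋆-algebraic direct limit. -/

/-- The Hilbert space `ℓ²` over the finitely supported configurations. -/
abbrev HilbertSp (S : Type u) (G : Type v) [AddCommGroup G] : Type (max u v) :=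
  lp (fun _ : S →₀ G => ℂ) 2

section Monomial

variable {I : Type v}

lemma memlp_monomial (e : I ≃ I) (w : I → Circle) (ψ : lp (fun _ : I => ℂ) 2) :
    Memℓp (fun i => (w i : ℂ) * ψ (e i)) 2 := by
  have h := (lp.memℓp ψ).summable (by norm_num)
  refine memℓp_gen ?_
  have h' := (Equiv.summable_iff e).mpr h
  simpa [Function.comp_def, Circle.norm_coe] using h'

/-- The isometric operator `(T ψ)(i) = w(i) ψ(e i)` given by a permutation and phases. -/
def monomialOp (e : I ≃ I) (w : I → Circle) :
    lp (fun _ : I => ℂ) 2 →L[ℂ] lp (fun _ : I => ℂ) 2 :=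
  LinearMap.mkContinuous
    { toFun := fun ψ => ⟨fun i => (w i : ℂ) * ψ (e i), memlp_monomial e w ψ⟩
      map_add' := fun ψ φ => by
        ext i
        exact mul_add _ _ _
      map_smul' := fun c ψ => by
        ext i
        exact mul_left_comm _ _ _ }
    1 (by
      intro ψ
      rw [one_mul]
      refine le_of_eq ?_
      have h2 : 0 < (2 : ENNReal).toReal := by norm_num
      rw [lp.norm_eq_tsum_rpow h2, lp.norm_eq_tsum_rpow h2]
      congr 1
      simp only [LinearMap.coe_mk, AddHom.coe_mk, norm_mul, Circle.norm_coe, one_mul]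
      exact Equiv.tsum_eq e (fun i => ‖ψ i‖ ^ (2 : ENNReal).toReal))

@[simp] lemma monomialOp_apply (e : I ≃ I) (w : I → Circle) (ψ : lp (fun _ : I => ℂ) 2) (i : I) :
    monomialOp e w ψ i = (w i : ℂ) * ψ (e i) := rfl

end Monomial

section Algebra

variable {S : Type u} {G : Type v} [AddCommGroup G] [Fintype G]

open Classical in
/-- The configuration that equals `k` on `Λ` and `h` elsewhere. -/
def replaceOn (Λ : Finset S) (h : S →₀ G) (k : Λ → G) : S →₀ G :=
  Finsupp.ofSupportFinite (fun s => if hs : s ∈ Λ then k ⟨s, hs⟩ else h s)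
    ((Λ.finite_toSet.union h.support.finite_toSet).subset fun s hs => by
      by_cases hΛ : s ∈ Λ
      · exact Or.inl hΛ
      · right
        simpa [hΛ] using hs)

open Classical in
/-- The operator `T` is `M ⊗ 1` where `M` is an operator on `ℓ²(G)^{⊗Λ} = ℓ²(Λ → G)`, given by its
matrix: `(T ψ)(h) = ∑_k M(h|_Λ, k) ψ(h with h|_Λ replaced by k)`. -/
def IsLocalOn (Λ : Finset S) (T : HilbertSp S G →L[ℂ] HilbertSp S G) : Prop :=
  ∃ M : Matrix (Λ → G) (Λ → G) ℂ, ∀ (ψ : HilbertSp S G) (h : S →₀ G),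
    T ψ h = ∑ k : Λ → G, M (fun s => h s) k * ψ (replaceOn Λ h k)

variable (S G) in
/-- The quasi-local algebra: the norm closure of the algebra of local operators. -/
def quasiLocal : StarSubalgebra ℂ (HilbertSp S G →L[ℂ] HilbertSp S G) :=
  (StarAlgebra.adjoin ℂ
    {T : HilbertSp S G →L[ℂ] HilbertSp S G | ∃ Λ : Finset S, IsLocalOn Λ T}).topologicalClosure

lemma mem_quasiLocal {Λ : Finset S} {T : HilbertSp S G →L[ℂ] HilbertSp S G}
    (h : IsLocalOn Λ T) : T ∈ quasiLocal S G :=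
  StarSubalgebra.le_topologicalClosure _ (StarAlgebra.subset_adjoin ℂ _ ⟨Λ, h⟩)

lemma isLocalOn_shift (a : S →₀ G) :
    IsLocalOn a.support (monomialOp (Equiv.subRight a) (fun _ => 1)) := by
  classical
  refine ⟨fun x k => if k = (fun s => x s - a s) then 1 else 0, fun ψ h => ?_⟩
  simp only [monomialOp_apply, ite_mul, one_mul, zero_mul, Finset.sum_ite_eq', Finset.mem_univ,
    if_true, Circle.coe_one]
  refine congrArg ψ (Finsupp.ext fun s => ?_)
  by_cases hs : s ∈ a.support
  · simp [replaceOn, Finsupp.ofSupportFinite, Finsupp.mem_support_iff.mp hs]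
  · simp [replaceOn, Finsupp.ofSupportFinite, Finsupp.notMem_support_iff.mp hs]

lemma isLocalOn_clock (b : S →₀ CharacterModule G) :
    IsLocalOn b.support (monomialOp (Equiv.refl (S →₀ G)) (fun h => phase (pairChain b h))) := by
  classical
  refine ⟨fun x k => if k = x then
    (phase (∑ s : b.support, b s (x s)) : ℂ) else 0, fun ψ h => ?_⟩
  simp only [monomialOp_apply, ite_mul, zero_mul, Finset.sum_ite_eq', Finset.mem_univ,
    if_true]
  congr 1
  · congr 2
    simp only [pairChain, Finsupp.sum]
    exact (Finset.sum_coe_sort b.support (fun s => b s (h s))).symm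
  · refine congrArg ψ (Finsupp.ext fun s => ?_)
    simp only [Equiv.refl_apply, replaceOn, Finsupp.ofSupportFinite, Finsupp.coe_mk]
    split_ifs <;> rfl

/-- `X^a |h⟩ = |a + h⟩`, the product over the sites of the operators `X^{a_α}`. -/
def opX (a : S →₀ G) : quasiLocal S G :=
  ⟨monomialOp (Equiv.subRight a) (fun _ => 1), mem_quasiLocal (isLocalOn_shift a)⟩

/-- `Z^b |h⟩ = ∏_α b_α(h_α) |h⟩`, the product over the sites of the operators `Z^{b_α}`. -/
def opZ (b : S →₀ CharacterModule G) : quasiLocal S G :=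
  ⟨monomialOp (Equiv.refl (S →₀ G)) (fun h => phase (pairChain b h)),
    mem_quasiLocal (isLocalOn_clock b)⟩

open Classical in
/-- The restriction of a family to a finite set `K` (zero outside `K`). -/
def truncate {A : Type v} [AddCommGroup A] (K : Finset S) (c : S → A) : S →₀ A :=
  Finsupp.onFinset K (fun s => if s ∈ K then c s else 0) (fun s hs => by
    by_contra h
    simp [h] at hs)

open Filter in
/-- `ρ_γ(A) = lim_{K → S} Z^{γ_K} A Z^{-γ_K}`, a norm limit over the finite subsets `K` of `S`. -/
def rhoZ (γ : S → CharacterModule G) (A : quasiLocal S G) : quasiLocal S G :=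
  limUnder atTop fun K : Finset S => opZ (truncate K γ) * A * opZ (-truncate K γ)

open Filter in
/-- `ρ_δ(A) = lim_{K → S} X^{δ_K} A X^{-δ_K}`, a norm limit over the finite subsets `K` of `S`. -/
def rhoX (δ : S → G) (A : quasiLocal S G) : quasiLocal S G :=
  limUnder atTop fun K : Finset S => opX (truncate K δ) * A * opX (-truncate K δ)

/-- The endomorphism `ρ_{(γ,δ)} = ρ_γ ∘ ρ_δ`. -/
def rho (γ : S → CharacterModule G) (δ : S → G) : quasiLocal S G → quasiLocal S G :=
  rhoZ γ ∘ rhoX δ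

/-- A state: a positive normalised linear functional. -/
structure IsState (ω : quasiLocal S G →ₗ[ℂ] ℂ) : Prop where
  nonneg : ∀ A : quasiLocal S G, 0 ≤ ω (star A * A)
  map_one : ω 1 = 1

end Algebra

/-! ## The model -/

section Model

variable {E : Type u} [TopologicalSpace E] [T2Space E] [CWComplex (Set.univ : Set E)]
  (o : CellOrientation E) (ho : o.LocallyFinite) (G : Type v) [AddCommGroup G] [Fintype G]

/-- The star operator `A_α = |G|⁻¹ ∑_g X^{∂ᵀ(g e_α)}` on the `n`-cells, for `α` an `m`-cell with
`m + 1 = n`. -/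
def starOp (n : ℕ) {m : ℕ} (α : Cell E m) : quasiLocal (Cell E n) G :=
  (Fintype.card G : ℂ)⁻¹ • ∑ g : G, opX (o.coboundarySingle ho m n α g)

/-- The plaquette operator `B_β = |G|⁻¹ ∑_χ Z^{∂(χ e_β)}` on the `n`-cells, for `β` an
`(n + 1)`-cell. -/
def plaquetteOp (n : ℕ) (β : Cell E (n + 1)) : quasiLocal (Cell E n) G :=
  (Fintype.card G : ℂ)⁻¹ •
    ∑ χ : CharacterModule G, opZ (o.boundary (n + 1) n (Finsupp.single β χ))

/-- A frustration-free ground state of the model on the `n`-cells: a state that minimises every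
interaction term `-A_α`, `-B_β` separately. As these operators are negatives of projections,
this means that all `A_α` and `B_β` have expectation `1`. -/
structure IsFrustrationFree (n : ℕ) (ω : quasiLocal (Cell E n) G →ₗ[ℂ] ℂ) : Prop where
  isState : IsState ω
  star_eq_one : ∀ m : ℕ, m + 1 = n → ∀ α : Cell E m, ω (starOp o ho G n α) = 1
  plaquette_eq_one : ∀ β : Cell E (n + 1), ω (plaquetteOp o G n β) = 1

end Model

end CellModel

end

noncomputable section

namespace CellModel

/-! ### Incidence numbers: the complex property and adjointness -/

section Incidence

variable {E : Type u} [TopologicalSpace E] [T2Space E] [CWComplex (Set.univ : Set E)]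

/-! The Weyl operators `X^a Z^b` span a dense subspace of the quasi-local algebra
(`dense_weylSpan`), and `ρ_{(γ,δ)}` multiplies each of them by the phase of `⟨γ,a⟩ - ⟨b,δ⟩`
(`exists_rho_eq`). States are continuous, so everything reduces to the question on which Weyl
operators a frustration-free ground state can be nonzero.

(1) ⇒ (2): each `A_α` and `B_β` is the average of a finite group of unitaries. If the average has
expectation `1`, positivity forces every unitary of the group to act trivially in the state, from
the left and from the right (`IsState.mul_eq_of_average_eq_one`). A Weyl operator `X^a Z^b` commutes
with such a unitary up to a phase, so its expectation vanishes unless the phase is `1`. Since `∂`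
and `∂ᵀ` are adjoint, this means that `b` is a cycle and `a` a cocycle. On these Weyl operators (1)
says that the two phases agree.

(2) ⇒ (1): a subgroup `H` of finite configurations yields a state with `ω(X^a) = 1` for `a ∈ H` and
`ω(Z^b) = 1` for `b ⊥ H`, as a weak limit of uniform superpositions (`exists_isState_of_subgroup`).
Both for `H` generated by the coboundaries of `(n-1)`-cells and for `H` the group of all locally
finite cocycles the state is frustration-free, by `∂ᵀ∂ᵀ = 0` and adjointness. The first gives every
cycle operator `Z^b` expectation `1`, the second every cocycle operator `X^a`, so (2) evaluated on
them returns the two pairings. Two states are used because `Z^b` and `X^a` need not commute. -/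

lemma cellularBoundary_comp (p q r : ℕ) (x : CellularGroup E p) :
    cellularBoundary E q r (cellularBoundary E p q x) = 0 := by
  obtain ⟨⟨c, hc⟩, rfl⟩ := QuotientAddGroup.mk_surjective x
  refine (QuotientAddGroup.eq_zero_iff _).mpr ?_
  rw [AddSubgroup.mem_addSubgroupOf]
  show singularD E q r (singularD E p q c) ∈ relBoundaries _ _ _
  rw [singularD_comp]
  exact zero_mem _

namespace CellOrientation

variable (o : CellOrientation E)

/-- The cell coordinates as an additive map. -/
lemma exists_cellCoord_eq (q : ℕ) :
    ∃ f : CellularGroup E q →+ (Cell E q →₀ ℤ), ∀ x, o.cellCoord q x = f x := by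
  by_cases h : LinearIndependent ℤ (o.cellClass q) ∧
      ⊤ ≤ Submodule.span ℤ (Set.range (o.cellClass q))
  · refine ⟨(Module.Basis.mk h.1 h.2).repr.toLinearMap.toAddMonoidHom, fun x => ?_⟩
    rw [cellCoord, dif_pos h]
    rfl
  · refine ⟨0, fun x => ?_⟩
    rw [cellCoord, dif_neg h]
    rfl

/-- The identity `∂ ∘ ∂ = 0` for the incidence numbers. -/
lemma sum_incidence_smul_incidence {p : ℕ} (q r : ℕ) (α : Cell E p) :
    (o.incidence q α).sum (fun β d => d • o.incidence r β) = 0 := by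
  classical
  -- If the cell classes were not a basis, the incidence numbers would take the default value `0`
  -- and the identity would be trivial. Hence it never has to be shown that they are a basis.
  by_cases h : LinearIndependent ℤ (o.cellClass q) ∧
      ⊤ ≤ Submodule.span ℤ (Set.range (o.cellClass q))
  · obtain ⟨f, hf⟩ := o.exists_cellCoord_eq r
    set x := cellularBoundary E p q (o.cellClass p α) with hx
    have hinc : o.incidence q α = (Module.Basis.mk h.1 h.2).repr x := by
      rw [incidence, cellCoord, dif_pos h]
    have hsum := (Module.Basis.mk h.1 h.2).linearCombination_repr x
    rw [← hinc, Finsupp.linearCombination_apply, Finsupp.sum] at hsum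
    have h0 : f (cellularBoundary E q r x) = 0 := by
      rw [hx, cellularBoundary_comp, map_zero]
    rw [← hsum, map_sum, map_sum] at h0
    simpa [Finsupp.sum, incidence, hf] using h0
  · have : o.incidence q α = 0 := by rw [incidence, cellCoord, dif_neg h]
    rw [this, Finsupp.sum_zero_index]

lemma sum_incidence_mul_incidence {p : ℕ} (q r : ℕ) (α : Cell E p) (τ : Cell E r) :
    (o.incidence q α).sum (fun β d => d * o.incidence r β τ) = 0 := by
  have h := DFunLike.congr_fun (o.sum_incidence_smul_incidence q r α) τ
  simpa [Finsupp.sum, Finsupp.finsetSum_apply] using h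

lemma coboundary_single {A : Type v} [AddCommGroup A] (q p : ℕ) (β : Cell E q) (g : A)
    (α : Cell E p) : o.coboundary q p (Finsupp.single β g) α = o.incidence q α β • g := by
  classical
  unfold coboundary
  refine (Finset.sum_eq_single β (fun β' _ hne => ?_) (fun hβ => ?_)).trans ?_
  · simp [hne.symm]
  · simp [Finsupp.notMem_support_iff.mp hβ]
  · simp

lemma coboundarySingle_apply (ho : o.LocallyFinite) {A : Type v} [AddCommGroup A] (q p : ℕ)
    (β : Cell E q) (g : A) (α : Cell E p) :
    o.coboundarySingle ho q p β g α = o.incidence q α β • g :=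
  o.coboundary_single q p β g α

lemma coboundary_coboundarySingle (ho : o.LocallyFinite) {A : Type v} [AddCommGroup A]
    (p q r : ℕ) (β : Cell E p) (g : A) :
    o.coboundary q r (o.coboundarySingle ho p q β g) = 0 := by
  ext α
  simp only [coboundary, coboundarySingle_apply, smul_smul, Pi.zero_apply]
  rw [Finsupp.sum, ← Finset.sum_smul]
  have h := o.sum_incidence_mul_incidence q p α β
  rw [Finsupp.sum] at h
  rw [h, zero_smul]

lemma coboundary_add {A : Type v} [AddCommGroup A] (q p : ℕ) (a b : Cell E q → A) :
    o.coboundary q p (a + b) = o.coboundary q p a + o.coboundary q p b := by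
  ext α
  simp [coboundary, Finsupp.sum, Finset.sum_add_distrib]

lemma coboundary_neg {A : Type v} [AddCommGroup A] (q p : ℕ) (a : Cell E q → A) :
    o.coboundary q p (-a) = -o.coboundary q p a := by
  ext α
  simp [coboundary, Finsupp.sum]

/-- The cocycles with finite support. -/
def lfCocycles (A : Type v) [AddCommGroup A] (n : ℕ) : AddSubgroup (Cell E n →₀ A) where
  carrier := {a | o.IsLFCocycle n a}
  zero_mem' := by
    show o.coboundary n (n + 1) _ = 0
    ext α
    simp [coboundary]
  add_mem' := fun {a b} ha hb => by
    show o.coboundary n (n + 1) _ = 0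
    rw [Finsupp.coe_add, coboundary_add, show o.coboundary n (n + 1) a = 0 from ha,
      show o.coboundary n (n + 1) b = 0 from hb, add_zero]
  neg_mem' := fun {a} ha => by
    show o.coboundary n (n + 1) _ = 0
    rw [Finsupp.coe_neg, coboundary_neg, show o.coboundary n (n + 1) a = 0 from ha, neg_zero]

lemma coboundarySingle_add (ho : o.LocallyFinite) {A : Type v} [AddCommGroup A] (q p : ℕ)
    (β : Cell E q) (g h : A) : o.coboundarySingle ho q p β (g + h) =
      o.coboundarySingle ho q p β g + o.coboundarySingle ho q p β h := by
  ext α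
  simp [coboundarySingle_apply]

lemma boundary_single {A : Type v} [AddCommGroup A] (p q : ℕ) (α : Cell E p) (χ : A)  :
    o.boundary p q (Finsupp.single α χ) =
      (o.incidence q α).mapRange (fun d : ℤ => d • χ) (zero_smul ℤ χ) := by
  unfold boundary
  rw [Finsupp.sum_single_index]
  ext
  simp

lemma boundary_single_add {A : Type v} [AddCommGroup A] (p q : ℕ) (α : Cell E p) (χ ψ : A) :
    o.boundary p q (Finsupp.single α (χ + ψ)) =
      o.boundary p q (Finsupp.single α χ) + o.boundary p q (Finsupp.single α ψ) := by
  simp only [boundary_single]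
  ext
  simp

lemma boundary_apply {A : Type v} [AddCommGroup A] (p q : ℕ) (b : Cell E p →₀ A) (β : Cell E q) :
    o.boundary p q b β = b.sum fun α χ => o.incidence q α β • χ := by
  simp [boundary, Finsupp.sum, Finsupp.finsetSum_apply]

variable {G : Type v} [AddCommGroup G]

/-- Adjointness of `∂` and `∂ᵀ`, tested on one cell: orthogonality to all coboundaries of `m`-cells
is the vanishing of the boundary. -/
lemma pairChain_coboundarySingle (ho : o.LocallyFinite) (n m : ℕ)
    (b : Cell E n →₀ CharacterModule G) (β : Cell E m) (g : G) :
    pairChain b (o.coboundarySingle ho m n β g) = o.boundary n m b β g := by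
  rw [boundary_apply]
  simp only [pairChain, coboundarySingle_apply, map_zsmul, Finsupp.sum]
  exact (map_sum (AddMonoidHom.eval g : (G →+ AddCircle (1 : ℚ)) →+ _)
    (fun x => o.incidence m x β • b x) b.support).symm

/-- The other half of adjointness: orthogonality to all boundaries of `p`-cells is the vanishing of
the coboundary, because characters separate the points of `G`. -/
lemma pairChain_boundary_single (p n : ℕ) (α : Cell E p) (χ : CharacterModule G)
    (a : Cell E n → G) :
    pairChain (o.boundary p n (Finsupp.single α χ)) a = χ (o.coboundary n p a α) := by
  rw [boundary_single, pairChain, Finsupp.sum_mapRange_index (fun _ => rfl)]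
  simp only [coboundary, Finsupp.sum, map_sum, map_zsmul]
  rfl

end CellOrientation

end Incidence

/-! ### Bilinearity of the pairings, and truncation -/

section Pairing

variable {S : Type u} {G : Type v} [AddCommGroup G]

lemma pairChain_eq_sum_of_subset (b : S →₀ CharacterModule G) (δ : S → G) {K : Finset S}
    (h : b.support ⊆ K) : pairChain b δ = ∑ s ∈ K, b s (δ s) :=
  Finsupp.sum_of_support_subset _ h _ (fun _ _ => rfl)

@[simp] lemma pairChain_zero_left (δ : S → G) :
    pairChain (0 : S →₀ CharacterModule G) δ = 0 := rfl

@[simp] lemma pairChain_zero_right (b : S →₀ CharacterModule G) : pairChain b (0 : S → G) = 0 := by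
  simp [pairChain]

lemma pairChain_add_left (b c : S →₀ CharacterModule G) (δ : S → G) :
    pairChain (b + c) δ = pairChain b δ + pairChain c δ :=
  Finsupp.sum_add_index' (fun _ => rfl) (fun _ _ _ => rfl)

lemma pairChain_neg_left (b : S →₀ CharacterModule G) (δ : S → G) :
    pairChain (-b) δ = -pairChain b δ := by
  rw [eq_neg_iff_add_eq_zero, ← pairChain_add_left, neg_add_cancel, pairChain_zero_left]

lemma pairChain_add_right (b : S →₀ CharacterModule G) (δ ε : S → G) :
    pairChain b (δ + ε) = pairChain b δ + pairChain b ε := by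
  simp [pairChain, Finsupp.sum, Finset.sum_add_distrib]

lemma pairChain_neg_right (b : S →₀ CharacterModule G) (δ : S → G) :
    pairChain b (-δ) = -pairChain b δ := by
  simp [pairChain, Finsupp.sum]

lemma pairChain_sub_right (b : S →₀ CharacterModule G) (δ ε : S → G) :
    pairChain b (δ - ε) = pairChain b δ - pairChain b ε := by
  rw [sub_eq_add_neg, pairChain_add_right, pairChain_neg_right, sub_eq_add_neg]

lemma pairLF_sub_left (γ γ' : S → CharacterModule G) (a : S →₀ G) :
    pairLF (γ - γ') a = pairLF γ a - pairLF γ' a := by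
  simp only [pairLF, Finsupp.sum, ← Finset.sum_sub_distrib]
  rfl

lemma truncate_apply_of_mem {A : Type v} [AddCommGroup A] {K : Finset S} (c : S → A) {s : S}
    (hs : s ∈ K) : truncate K c s = c s := by
  simp [truncate, hs]

lemma truncate_support_subset {A : Type v} [AddCommGroup A] (K : Finset S) (c : S → A) :
    (truncate K c).support ⊆ K :=
  Finsupp.support_onFinset_subset

lemma pairChain_truncate_right {K : Finset S} (b : S →₀ CharacterModule G) (δ : S → G)
    (h : b.support ⊆ K) : pairChain b (truncate K δ) = pairChain b δ :=
  Finset.sum_congr rfl fun s hs => by simp only [truncate_apply_of_mem δ (h hs)]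

lemma pairChain_truncate_left {K : Finset S} (γ : S → CharacterModule G) (a : S →₀ G)
    (h : a.support ⊆ K) : pairChain (truncate K γ) a = pairLF γ a := by
  rw [pairChain_eq_sum_of_subset _ _ (truncate_support_subset K γ), pairLF,
    Finsupp.sum_of_support_subset _ h _ (fun s _ => map_zero (γ s))]
  exact Finset.sum_congr rfl fun s hs => by rw [truncate_apply_of_mem γ hs]

end Pairing

/-! ### Phases and orthogonality of characters -/

section Phase

lemma phase_add (s t : AddCircle (1 : ℚ)) : phase (s + t) = phase s * phase t := by
  simp [phase]

@[simp] lemma phase_zero : phase 0 = 1 := by simp [phase]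

lemma phase_neg (t : AddCircle (1 : ℚ)) : phase (-t) = (phase t)⁻¹ := by
  simp [phase]

lemma phase_sum {ι : Type*} (s : Finset ι) (f : ι → AddCircle (1 : ℚ)) :
    phase (∑ i ∈ s, f i) = ∏ i ∈ s, phase (f i) := by
  classical
  induction s using Finset.induction_on with
  | empty => simp
  | insert i s hi ih => rw [Finset.sum_insert hi, Finset.prod_insert hi, phase_add, ih]

lemma coe_phase_sum {ι : Type*} (s : Finset ι) (f : ι → AddCircle (1 : ℚ)) :
    (phase (∑ i ∈ s, f i) : ℂ) = ∏ i ∈ s, (phase (f i) : ℂ) := by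
  rw [phase_sum]
  exact map_prod Circle.coeHom _ _

lemma phase_eq_one_iff {t : AddCircle (1 : ℚ)} : phase t = 1 ↔ t = 0 := by
  refine ⟨fun h => ?_, fun h => by rw [h, phase_zero]⟩
  obtain ⟨q, rfl⟩ := QuotientAddGroup.mk_surjective t
  have h' : Circle.exp (2 * Real.pi * (q : ℝ)) = 1 := h
  obtain ⟨k, hk⟩ := Circle.exp_eq_one.mp h'
  have hq : (q : ℝ) = k := by
    have := Real.pi_pos
    field_simp at hk
    linarith
  have hq' : q = k := by exact_mod_cast hq
  refine (QuotientAddGroup.eq_zero_iff _).mpr ?_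
  exact AddSubgroup.mem_zmultiples_iff.mpr ⟨k, by simp [hq']⟩

lemma phase_injective : Function.Injective phase := by
  intro s t h
  rw [← sub_eq_zero, ← phase_eq_one_iff, sub_eq_add_neg, phase_add, phase_neg, h, mul_inv_cancel]

lemma phase_coe_ne_one {t : AddCircle (1 : ℚ)} (h : t ≠ 0) : (phase t : ℂ) ≠ 1 := by
  rw [Ne, Circle.coe_eq_one, phase_eq_one_iff]
  exact h

/-- Translation by `i` permutes the summands and multiplies the sum by `f i ≠ 1`. -/
lemma sum_eq_zero_of_phase_mul {ι : Type*} [Fintype ι] [AddGroup ι] (f : ι → ℂ)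
    (hf : ∀ i j, f (i + j) = f i * f j) (i : ι) (hi : f i ≠ 1) : ∑ j, f j = 0 := by
  have h : f i * ∑ j, f j = ∑ j, f j := by
    rw [Finset.mul_sum]
    simp only [← hf]
    exact Equiv.sum_comp (Equiv.addLeft i) f
  have h2 : (f i - 1) * ∑ j, f j = 0 := by rw [sub_mul, h, one_mul, sub_self]
  exact (mul_eq_zero.mp h2).resolve_left (sub_ne_zero.mpr hi)

variable {G : Type v} [AddCommGroup G] [Fintype G]

lemma sum_phase_eq_zero_of_ne_zero {χ : CharacterModule G} (hχ : χ ≠ 0) :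
    ∑ g : G, (phase (χ g) : ℂ) = 0 := by
  obtain ⟨g, hg⟩ := DFunLike.ne_iff.mp hχ
  exact sum_eq_zero_of_phase_mul (fun g : G => (phase (χ g) : ℂ))
    (fun i j => by rw [map_add, phase_add, Circle.coe_mul]) g (phase_coe_ne_one hg)

lemma sum_phase_char_eq_zero_of_ne_zero {g : G} (hg : g ≠ 0) :
    ∑ χ : CharacterModule G, (phase (χ g) : ℂ) = 0 := by
  obtain ⟨χ, hχ⟩ := CharacterModule.exists_character_apply_ne_zero_of_ne_zero hg
  refine sum_eq_zero_of_phase_mul (fun χ : CharacterModule G => (phase (χ g) : ℂ))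
    (fun i j => ?_) χ (phase_coe_ne_one hχ)
  rw [← Circle.coe_mul, ← phase_add]
  rfl

variable (G) in
-- Double counting: summing the phases of `χ g` over all pairs, in either order, leaves only the
-- zero element of the outer group.
lemma card_characterModule : Fintype.card (CharacterModule G) = Fintype.card G := by
  classical
  have h := Finset.sum_comm (s := Finset.univ) (t := Finset.univ)
    (f := fun (g : G) (χ : CharacterModule G) => (phase (χ g) : ℂ))
  rw [Fintype.sum_eq_single 0 (fun g hg => sum_phase_char_eq_zero_of_ne_zero hg),
    Fintype.sum_eq_single 0 (fun χ hχ => sum_phase_eq_zero_of_ne_zero hχ)] at h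
  have h1 : ∀ x : G, (0 : CharacterModule G) x = 0 := fun _ => rfl
  simp only [map_zero, phase_zero, Circle.coe_one, h1, Finset.sum_const, Finset.card_univ,
    nsmul_eq_mul, mul_one] at h
  exact_mod_cast h

/-- Orthogonality of characters on `Λ → G`. -/
lemma sum_phase_pi {Λ : Type*} [Fintype Λ] [DecidableEq Λ] (d : Λ → G) :
    ∑ χ : Λ → CharacterModule G, (phase (∑ s, χ s (d s)) : ℂ) =
      open Classical in if d = 0 then (Fintype.card G : ℂ) ^ Fintype.card Λ else 0 := by
  classical
  -- The sum over families of characters factors into a product over `Λ`; a single coordinate with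
  -- `d s ≠ 0` makes it vanish.
  simp only [coe_phase_sum]
  have h := Finset.prod_univ_sum (fun _ : Λ => (Finset.univ : Finset (CharacterModule G)))
    (fun s χ => (phase (χ (d s)) : ℂ))
  rw [Fintype.piFinset_univ] at h
  rw [← h]
  split_ifs with hd
  · simp [hd, card_characterModule G]
  · obtain ⟨s, hs⟩ := Function.ne_iff.mp hd
    exact Finset.prod_eq_zero (Finset.mem_univ s) (sum_phase_char_eq_zero_of_ne_zero hs)

end Phase

/-! ### Changing a configuration on a finite set -/

section Replace

variable {S : Type u} {G : Type v} [AddCommGroup G]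

lemma replaceOn_apply_of_mem {A : Type v} [AddCommGroup A] {Λ : Finset S} (h : S →₀ A) (k : Λ → A)
    {s : S} (hs : s ∈ Λ) : replaceOn Λ h k s = k ⟨s, hs⟩ :=
  dif_pos hs

lemma replaceOn_apply_of_notMem {A : Type v} [AddCommGroup A] {Λ : Finset S} (h : S →₀ A)
    (k : Λ → A) {s : S} (hs : s ∉ Λ) : replaceOn Λ h k s = h s :=
  dif_neg hs

lemma pairChain_replaceOn_zero {Λ : Finset S} (χ : Λ → CharacterModule G) (d : S → G) :
    pairChain (replaceOn Λ 0 χ) d = ∑ s : Λ, χ s (d s) := by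
  rw [pairChain_eq_sum_of_subset (K := Λ), ← Finset.sum_coe_sort Λ]
  · exact Finset.sum_congr rfl fun s _ => by rw [replaceOn_apply_of_mem _ _ s.2]
  · intro s hs
    by_contra h
    exact Finsupp.mem_support_iff.mp hs (replaceOn_apply_of_notMem _ _ h)

end Replace

/-! ### Weyl operators and their density -/

section Weyl

variable {S : Type u} {G : Type v} [AddCommGroup G] [Fintype G]

lemma quasiLocal_ext {A B : quasiLocal S G}
    (h : ∀ (ψ : HilbertSp S G) (i : S →₀ G), A.1 ψ i = B.1 ψ i) : A = B := by
  refine Subtype.ext (ContinuousLinearMap.ext fun ψ => ?_)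
  ext i
  exact h ψ i

lemma opX_apply (a : S →₀ G) (ψ : HilbertSp S G) (h : S →₀ G) :
    (opX a).1 ψ h = ψ (h - a) := by
  show ((1 : Circle) : ℂ) * ψ (h - a) = _
  simp

lemma opZ_apply (b : S →₀ CharacterModule G) (ψ : HilbertSp S G) (h : S →₀ G) :
    (opZ b).1 ψ h = (phase (pairChain b h) : ℂ) * ψ h := rfl

lemma coe_mul_apply (A B : quasiLocal S G) (ψ : HilbertSp S G) :
    (A * B).1 ψ = A.1 (B.1 ψ) := rfl

lemma coe_smul_apply (c : ℂ) (A : quasiLocal S G) (ψ : HilbertSp S G) (h : S →₀ G) :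
    (c • A).1 ψ h = c * A.1 ψ h := rfl

@[simp] lemma opX_zero : opX (0 : S →₀ G) = 1 := by
  refine quasiLocal_ext fun ψ i => ?_
  rw [opX_apply, sub_zero]
  rfl

@[simp] lemma opZ_zero : opZ (0 : S →₀ CharacterModule G) = 1 := by
  refine quasiLocal_ext fun ψ i => ?_
  rw [opZ_apply]
  simp

lemma opX_add (a c : S →₀ G) : opX (a + c) = opX a * opX c := by
  refine quasiLocal_ext fun ψ i => ?_
  rw [coe_mul_apply, opX_apply, opX_apply, opX_apply, sub_sub]

lemma opZ_add (b c : S →₀ CharacterModule G) : opZ (b + c) = opZ b * opZ c := by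
  refine quasiLocal_ext fun ψ i => ?_
  rw [coe_mul_apply, opZ_apply, opZ_apply, opZ_apply, pairChain_add_left, phase_add,
    Circle.coe_mul, mul_assoc]

/-- The Weyl commutation relation, from which all phases below arise: `Z^b` reads the configuration
before or after the shift by `a`. -/
lemma opZ_mul_opX (b : S →₀ CharacterModule G) (a : S →₀ G) :
    opZ b * opX a = (phase (pairChain b a) : ℂ) • (opX a * opZ b) := by
  refine quasiLocal_ext fun ψ i => ?_
  rw [coe_mul_apply, coe_smul_apply, coe_mul_apply, opZ_apply, opX_apply, opX_apply, opZ_apply,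
    ← mul_assoc, ← Circle.coe_mul, ← phase_add, ← pairChain_add_right, Finsupp.coe_sub]
  simp

lemma norm_monomialOp_le {I : Type v} (e : I ≃ I) (w : I → Circle) : ‖monomialOp e w‖ ≤ 1 :=
  LinearMap.mkContinuous_norm_le _ zero_le_one _

lemma norm_opX_le (a : S →₀ G) : ‖opX a‖ ≤ 1 := norm_monomialOp_le _ _

lemma norm_opZ_le (b : S →₀ CharacterModule G) : ‖opZ b‖ ≤ 1 := norm_monomialOp_le _ _

lemma star_opX (a : S →₀ G) : star (opX a) = opX (-a) := by
  refine Subtype.ext ?_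
  show ContinuousLinearMap.adjoint (opX a).1 = (opX (-a)).1
  refine ((ContinuousLinearMap.eq_adjoint_iff _ _).mpr fun φ ψ => ?_).symm
  rw [lp.inner_eq_tsum, lp.inner_eq_tsum, ← Equiv.tsum_eq (Equiv.subRight a)]
  refine tsum_congr fun i => ?_
  rw [opX_apply, opX_apply, Equiv.subRight_apply, sub_neg_eq_add, sub_add_cancel]

lemma star_opZ (b : S →₀ CharacterModule G) : star (opZ b) = opZ (-b) := by
  refine Subtype.ext ?_
  show ContinuousLinearMap.adjoint (opZ b).1 = (opZ (-b)).1
  refine ((ContinuousLinearMap.eq_adjoint_iff _ _).mpr fun φ ψ => ?_).symm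
  rw [lp.inner_eq_tsum, lp.inner_eq_tsum]
  refine tsum_congr fun i => ?_
  rw [opZ_apply, opZ_apply, pairChain_neg_left, phase_neg, Circle.coe_inv_eq_conj]
  simp only [RCLike.inner_apply, map_mul, Complex.conj_conj]
  ring

/-- The Weyl operator `X^a Z^b`. -/
def weyl (p : (S →₀ G) × (S →₀ CharacterModule G)) : quasiLocal S G := opX p.1 * opZ p.2

lemma weyl_mul_weyl (p q : (S →₀ G) × (S →₀ CharacterModule G)) :
    weyl p * weyl q = (phase (pairChain p.2 q.1) : ℂ) • weyl (p + q) := by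
  simp only [weyl, Prod.fst_add, Prod.snd_add, opX_add, opZ_add]
  rw [mul_assoc, ← mul_assoc (opZ p.2), opZ_mul_opX]
  simp only [smul_mul_assoc, mul_smul_comm, mul_assoc]

lemma star_weyl (p : (S →₀ G) × (S →₀ CharacterModule G)) :
    star (weyl p) = (phase (pairChain p.2 p.1) : ℂ) • weyl (-p) := by
  simp only [weyl, star_mul, star_opX, star_opZ, Prod.fst_neg, Prod.snd_neg]
  rw [opZ_mul_opX, Finsupp.coe_neg, pairChain_neg_right, pairChain_neg_left, neg_neg]

variable (S G) in
/-- The linear span of the Weyl operators. -/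
def weylSpan : Submodule ℂ (quasiLocal S G) := Submodule.span ℂ (Set.range weyl)

lemma weyl_mem_weylSpan (p : (S →₀ G) × (S →₀ CharacterModule G)) : weyl p ∈ weylSpan S G :=
  Submodule.subset_span ⟨p, rfl⟩

lemma opX_mem_weylSpan (a : S →₀ G) : opX a ∈ weylSpan S G := by
  simpa [weyl] using weyl_mem_weylSpan (a, (0 : S →₀ CharacterModule G))

lemma opZ_mem_weylSpan (b : S →₀ CharacterModule G) : opZ b ∈ weylSpan S G := by
  simpa [weyl] using weyl_mem_weylSpan ((0 : S →₀ G), b)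

lemma mul_mem_weylSpan {A B : quasiLocal S G} (hA : A ∈ weylSpan S G) (hB : B ∈ weylSpan S G) :
    A * B ∈ weylSpan S G := by
  have h : weylSpan S G * weylSpan S G ≤ weylSpan S G := by
    unfold weylSpan
    rw [Submodule.span_mul_span, Submodule.span_le]
    rintro _ ⟨_, ⟨p, rfl⟩, _, ⟨q, rfl⟩, rfl⟩
    show weyl p * weyl q ∈ weylSpan S G
    rw [weyl_mul_weyl]
    exact Submodule.smul_mem _ _ (weyl_mem_weylSpan _)
  exact h (Submodule.mul_mem_mul hA hB)

lemma star_mem_weylSpan {A : quasiLocal S G} (hA : A ∈ weylSpan S G) :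
    star A ∈ weylSpan S G := by
  induction hA using Submodule.span_induction with
  | mem x hx =>
    obtain ⟨p, rfl⟩ := hx
    rw [star_weyl]
    exact Submodule.smul_mem _ _ (weyl_mem_weylSpan _)
  | zero => rw [star_zero]; exact zero_mem _
  | add x y _ _ hx hy => rw [star_add]; exact add_mem hx hy
  | smul c x _ hx => rw [star_smul]; exact Submodule.smul_mem _ _ hx

/-! ### Local operators as combinations of Weyl operators -/

section Local

/-- The projection onto the configurations that agree with `k` on `Λ`. -/
def configProj (Λ : Finset S) (k : Λ → G) : quasiLocal S G :=
  open Classical in ((Fintype.card G : ℂ) ^ Fintype.card Λ)⁻¹ • ∑ χ : Λ → CharacterModule G,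
    (phase (-∑ s, χ s (k s)) : ℂ) • opZ (replaceOn Λ 0 χ)

lemma configProj_mem_weylSpan (Λ : Finset S) (k : Λ → G) : configProj Λ k ∈ weylSpan S G :=
  Submodule.smul_mem _ _ (Submodule.sum_mem _ fun _ _ =>
    Submodule.smul_mem _ _ (opZ_mem_weylSpan _))

lemma coe_sum_apply {ι : Type*} (s : Finset ι) (A : ι → quasiLocal S G) (ψ : HilbertSp S G)
    (h : S →₀ G) : (∑ i ∈ s, A i).1 ψ h = ∑ i ∈ s, (A i).1 ψ h := by
  classical
  induction s using Finset.induction_on with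
  | empty => simp
  | insert i s hi ih =>
    rw [Finset.sum_insert hi, Finset.sum_insert hi, ← ih]
    rfl

open Classical in
-- Fourier inversion on the finite group `Λ → G`.
lemma configProj_apply (Λ : Finset S) (k : Λ → G) (ψ : HilbertSp S G) (h : S →₀ G) :
    (configProj Λ k).1 ψ h = if (fun s : Λ => h s) = k then ψ h else 0 := by
  have hG : (Fintype.card G : ℂ) ^ Fintype.card Λ ≠ 0 :=
    pow_ne_zero _ (Nat.cast_ne_zero.mpr Fintype.card_ne_zero)
  rw [configProj, coe_smul_apply, coe_sum_apply]
  have h1 : ∀ χ : Λ → CharacterModule G,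
      ((phase (-∑ s, χ s (k s)) : ℂ) • opZ (replaceOn Λ 0 χ)).1 ψ h =
        (phase (∑ s, χ s (h s - k s)) : ℂ) * ψ h := by
    intro χ
    rw [coe_smul_apply, opZ_apply, ← mul_assoc, ← Circle.coe_mul, ← phase_add,
      pairChain_replaceOn_zero, neg_add_eq_sub, ← Finset.sum_sub_distrib]
    simp only [map_sub]
  simp only [h1]
  rw [← Finset.sum_mul, sum_phase_pi (fun s : Λ => h s - k s)]
  have h2 : (fun s : Λ => h s - k s) = 0 ↔ (fun s : Λ => h s) = k := sub_eq_zero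
  simp only [h2]
  split_ifs
  · rw [← mul_assoc, inv_mul_cancel₀ hG, one_mul]
  · simp

lemma exists_weylSpan_of_isLocalOn {Λ : Finset S} {T : HilbertSp S G →L[ℂ] HilbertSp S G}
    (hT : IsLocalOn Λ T) : ∃ A ∈ weylSpan S G, A.1 = T := by
  classical
  obtain ⟨M, hM⟩ := hT
  -- The matrix unit `|x⟩⟨k|` is the projection onto `k` followed by the shift by `x - k`.
  refine ⟨∑ x : Λ → G, ∑ k : Λ → G,
    M x k • (opX (replaceOn Λ 0 (x - k)) * configProj Λ k), ?_, ?_⟩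
  · exact Submodule.sum_mem _ fun x _ => Submodule.sum_mem _ fun k _ => Submodule.smul_mem _ _
      (mul_mem_weylSpan (opX_mem_weylSpan _) (configProj_mem_weylSpan _ _))
  · refine ContinuousLinearMap.ext fun ψ => ?_
    refine lp.ext (funext fun h => ?_)
    rw [hM, coe_sum_apply]
    have key : ∀ x k : Λ → G,
        (M x k • (opX (replaceOn Λ 0 (x - k)) * configProj Λ k)).1 ψ h =
          if (fun s : Λ => h s) = x then M x k * ψ (replaceOn Λ h k) else 0 := by
      intro x k
      rw [coe_smul_apply, coe_mul_apply, opX_apply, configProj_apply]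
      have h2 : (fun s : Λ => (h - replaceOn Λ 0 (x - k)) s) = k ↔ (fun s : Λ => h s) = x := by
        rw [funext_iff, funext_iff]
        refine forall_congr' fun s => ?_
        rw [Finsupp.sub_apply, replaceOn_apply_of_mem _ _ s.2, Pi.sub_apply, sub_eq_iff_eq_add,
          add_sub_cancel]
      simp only [h2]
      split_ifs with hx
      · refine congrArg (fun j => M x k * ψ j) (Finsupp.ext fun s => ?_)
        by_cases hs : s ∈ Λ
        · rw [Finsupp.sub_apply, replaceOn_apply_of_mem _ _ hs, replaceOn_apply_of_mem _ _ hs,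
            ← hx, Pi.sub_apply, sub_sub_cancel]
        · rw [Finsupp.sub_apply, replaceOn_apply_of_notMem _ _ hs,
            replaceOn_apply_of_notMem _ _ hs, Finsupp.zero_apply, sub_zero]
      · rw [mul_zero]
    simp only [coe_sum_apply, key]
    rw [Finset.sum_eq_single (fun s : Λ => h s)]
    · simp
    · intro x _ hx
      simp [hx.symm]
    · simp

end Local

lemma exists_weylSpan_of_mem_adjoin {T : HilbertSp S G →L[ℂ] HilbertSp S G}
    (hT : T ∈ StarAlgebra.adjoin ℂ
      {T : HilbertSp S G →L[ℂ] HilbertSp S G | ∃ Λ : Finset S, IsLocalOn Λ T}) :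
    ∃ A ∈ weylSpan S G, A.1 = T := by
  induction hT using StarAlgebra.adjoin_induction with
  | mem x hx =>
    obtain ⟨Λ, hΛ⟩ := hx
    exact exists_weylSpan_of_isLocalOn hΛ
  | algebraMap r =>
    refine ⟨r • 1, Submodule.smul_mem _ _ ?_, ?_⟩
    · rw [← opX_zero]
      exact opX_mem_weylSpan _
    · rw [Algebra.algebraMap_eq_smul_one]
      rfl
  | add x y _ _ hx hy =>
    obtain ⟨A, hA, rfl⟩ := hx
    obtain ⟨B, hB, rfl⟩ := hy
    exact ⟨A + B, add_mem hA hB, rfl⟩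
  | mul x y _ _ hx hy =>
    obtain ⟨A, hA, rfl⟩ := hx
    obtain ⟨B, hB, rfl⟩ := hy
    exact ⟨A * B, mul_mem_weylSpan hA hB, rfl⟩
  | star x _ hx =>
    obtain ⟨A, hA, rfl⟩ := hx
    exact ⟨star A, star_mem_weylSpan hA, rfl⟩

lemma dense_weylSpan : Dense (weylSpan S G : Set (quasiLocal S G)) := by
  intro A
  rw [Topology.IsInducing.subtypeVal.closure_eq_preimage_closure_image]
  have h : A.1 ∈ closure ((StarAlgebra.adjoin ℂ
      {T : HilbertSp S G →L[ℂ] HilbertSp S G | ∃ Λ : Finset S, IsLocalOn Λ T} :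
        StarSubalgebra ℂ _) : Set (HilbertSp S G →L[ℂ] HilbertSp S G)) := A.2
  refine closure_mono ?_ h
  intro T hT
  obtain ⟨B, hB, rfl⟩ := exists_weylSpan_of_mem_adjoin hT
  exact ⟨B, hB, rfl⟩

lemma isClosed_quasiLocal :
    IsClosed (quasiLocal S G : Set (HilbertSp S G →L[ℂ] HilbertSp S G)) :=
  StarSubalgebra.isClosed_topologicalClosure _

lemma completeSpace_quasiLocal : CompleteSpace (quasiLocal S G) :=
  isClosed_quasiLocal.completeSpace_coe

lemma eq_of_eq_on_weyl {V : Type*} [NormedAddCommGroup V] [NormedSpace ℂ V]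
    {f g : quasiLocal S G →L[ℂ] V} (h : ∀ p, f (weyl p) = g (weyl p)) : f = g := by
  refine ContinuousLinearMap.ext_on (s := Set.range weyl) dense_weylSpan ?_
  rintro _ ⟨p, rfl⟩
  exact h p

end Weyl

/-! ### Limits of nets of contractions -/

section Limits

open Filter

/-- The `ε/3` argument: contractions converging on a dense subspace are Cauchy at every point, and
the pointwise limit is again a linear contraction. -/
lemma exists_continuousLinearMap_tendsto {Q ι : Type*} [NormedAddCommGroup Q] [NormedSpace ℂ Q]
    [CompleteSpace Q] [Nonempty ι] [SemilatticeSup ι] (F : ι → Q →L[ℂ] Q)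
    (hF : ∀ i A, ‖F i A‖ ≤ ‖A‖) (D : Submodule ℂ Q) (hD : Dense (D : Set Q))
    (hlim : ∀ A ∈ D, ∃ L, Tendsto (fun i => F i A) atTop (𝓝 L)) :
    ∃ R : Q →L[ℂ] Q, ∀ A, Tendsto (fun i => F i A) atTop (𝓝 (R A)) := by
  have hex : ∀ A, ∃ L, Tendsto (fun i => F i A) atTop (𝓝 L) := by
    intro A
    refine cauchySeq_tendsto_of_complete (Metric.cauchySeq_iff'.mpr fun ε hε => ?_)
    obtain ⟨B, hB, hAB⟩ := hD.exists_dist_lt A (ε := ε / 3) (by positivity)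
    obtain ⟨L, hL⟩ := hlim B hB
    obtain ⟨N, hN⟩ := Metric.cauchySeq_iff'.mp hL.cauchySeq (ε / 3) (by positivity)
    refine ⟨N, fun n hn => ?_⟩
    have hi : ∀ i, dist (F i A) (F i B) < ε / 3 := fun i => by
      rw [dist_eq_norm, ← map_sub]
      exact (hF i _).trans_lt (by rwa [← dist_eq_norm])
    have h1 := hi n
    have h2 := hi N
    rw [dist_comm] at h2
    calc dist (F n A) (F N A) ≤ dist (F n A) (F n B) + dist (F n B) (F N B) +
          dist (F N B) (F N A) := dist_triangle4 _ _ _ _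
      _ < ε := by linarith [hN n hn]
  choose R hR using hex
  refine ⟨LinearMap.mkContinuous
    { toFun := R
      map_add' := fun A B => tendsto_nhds_unique (hR (A + B))
        (by simpa using (hR A).add (hR B))
      map_smul' := fun c A => tendsto_nhds_unique (hR (c • A))
        (by simpa using (hR A).const_smul c) } 1 fun A => ?_, hR⟩
  rw [one_mul]
  exact le_of_tendsto (hR A).norm (Eventually.of_forall fun i => hF i A)

end Limits

/-! ### The endomorphisms `ρ` act on Weyl operators by phases -/

section Rho

open Filter

variable {S : Type u} {G : Type v} [AddCommGroup G] [Fintype G]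

lemma opX_mul_weyl_mul_opX_neg (c : S →₀ G) (p : (S →₀ G) × (S →₀ CharacterModule G)) :
    opX c * weyl p * opX (-c) = (phase (-pairChain p.2 c) : ℂ) • weyl p := by
  rw [weyl, mul_assoc, mul_assoc (opX p.1), opZ_mul_opX, Finsupp.coe_neg, pairChain_neg_right]
  simp only [mul_smul_comm, ← mul_assoc, ← opX_add]
  congr 3
  abel

lemma opZ_mul_weyl_mul_opZ_neg (c : S →₀ CharacterModule G)
    (p : (S →₀ G) × (S →₀ CharacterModule G)) :
    opZ c * weyl p * opZ (-c) = (phase (pairChain c p.1) : ℂ) • weyl p := by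
  rw [weyl, ← mul_assoc, opZ_mul_opX]
  simp only [smul_mul_assoc, mul_assoc, ← opZ_add]
  congr 3
  abel

/-- On a fixed Weyl operator the net is eventually constant, so it converges on their span; the norm
bounds extend convergence to the whole algebra. -/
lemma exists_conj_tendsto (U V : Finset S → quasiLocal S G) (hU : ∀ K, ‖U K‖ ≤ 1)
    (hV : ∀ K, ‖V K‖ ≤ 1) (c : (S →₀ G) × (S →₀ CharacterModule G) → ℂ)
    (hc : ∀ p, ∀ᶠ K in atTop, U K * weyl p * V K = c p • weyl p) :
    ∃ R : quasiLocal S G →L[ℂ] quasiLocal S G,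
      (∀ A, Tendsto (fun K => U K * A * V K) atTop (𝓝 (R A))) ∧
      ∀ p, R (weyl p) = c p • weyl p := by
  classical
  have hlim : ∀ p, Tendsto (fun K => U K * weyl p * V K) atTop (𝓝 (c p • weyl p)) := fun p =>
    tendsto_const_nhds.congr' ((hc p).mono fun K h => h.symm)
  have := completeSpace_quasiLocal (S := S) (G := G)
  obtain ⟨R, hR⟩ := exists_continuousLinearMap_tendsto
    (fun K => ContinuousLinearMap.mulLeftRight ℂ (quasiLocal S G) (U K) (V K))
    (fun K A => by
      rw [ContinuousLinearMap.mulLeftRight_apply]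
      calc ‖U K * A * V K‖ ≤ ‖U K‖ * ‖A‖ * ‖V K‖ :=
            (norm_mul_le _ _).trans (mul_le_mul_of_nonneg_right (norm_mul_le _ _) (norm_nonneg _))
        _ ≤ 1 * ‖A‖ * 1 := by
            gcongr
            · exact hU K
            · exact hV K
        _ = ‖A‖ := by ring)
    (weylSpan S G) dense_weylSpan (fun A hA => by
      induction hA using Submodule.span_induction with
      | mem x hx =>
        obtain ⟨p, rfl⟩ := hx
        exact ⟨_, hlim p⟩
      | zero => exact ⟨0, by simp⟩
      | add x y _ _ hx hy =>
        obtain ⟨L, hL⟩ := hx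
        obtain ⟨L', hL'⟩ := hy
        exact ⟨L + L', by simpa only [map_add] using hL.add hL'⟩
      | smul r x _ hx =>
        obtain ⟨L, hL⟩ := hx
        exact ⟨r • L, by simpa only [map_smul] using hL.const_smul r⟩)
  refine ⟨R, hR, fun p => tendsto_nhds_unique (hR (weyl p)) (hlim p)⟩

/-- A `limUnder` carries information only if the limit exists; convergence at every `A` identifies
it with a continuous linear map. Once `K` contains the support of `p.2`, truncating `δ` to `K` no
longer affects the phase. -/
lemma exists_rhoX_eq (δ : S → G) : ∃ R : quasiLocal S G →L[ℂ] quasiLocal S G,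
    (∀ A, rhoX δ A = R A) ∧
      ∀ p, R (weyl p) = (phase (-pairChain p.2 δ) : ℂ) • weyl p := by
  obtain ⟨R, hR, hRw⟩ := exists_conj_tendsto (fun K => opX (truncate K δ))
    (fun K => opX (-truncate K δ)) (fun K => norm_opX_le _) (fun K => norm_opX_le _)
    (fun p => (phase (-pairChain p.2 δ) : ℂ)) (fun p => by
      filter_upwards [eventually_ge_atTop p.2.support] with K hK
      rw [opX_mul_weyl_mul_opX_neg, pairChain_truncate_right _ _ hK])
  exact ⟨R, fun A => (hR A).limUnder_eq, hRw⟩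

lemma exists_rhoZ_eq (γ : S → CharacterModule G) :
    ∃ R : quasiLocal S G →L[ℂ] quasiLocal S G, (∀ A, rhoZ γ A = R A) ∧
      ∀ p, R (weyl p) = (phase (pairLF γ p.1) : ℂ) • weyl p := by
  obtain ⟨R, hR, hRw⟩ := exists_conj_tendsto (fun K => opZ (truncate K γ))
    (fun K => opZ (-truncate K γ)) (fun K => norm_opZ_le _) (fun K => norm_opZ_le _)
    (fun p => (phase (pairLF γ p.1) : ℂ)) (fun p => by
      filter_upwards [eventually_ge_atTop p.1.support] with K hK
      rw [opZ_mul_weyl_mul_opZ_neg, pairChain_truncate_left _ _ hK])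
  exact ⟨R, fun A => (hR A).limUnder_eq, hRw⟩

/-- `ρ_{(γ,δ)}` is a continuous linear map that acts on the Weyl operators by phases. -/
lemma exists_rho_eq (γ : S → CharacterModule G) (δ : S → G) :
    ∃ R : quasiLocal S G →L[ℂ] quasiLocal S G, (∀ A, rho γ δ A = R A) ∧
      ∀ p, R (weyl p) =
        (phase (pairLF γ p.1 - pairChain p.2 δ) : ℂ) • weyl p := by
  obtain ⟨RX, hX, hXw⟩ := exists_rhoX_eq δ
  obtain ⟨RZ, hZ, hZw⟩ := exists_rhoZ_eq γ
  refine ⟨RZ.comp RX, fun A => ?_, fun p => ?_⟩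
  · show rhoZ γ (rhoX δ A) = _
    rw [hX, hZ]
    rfl
  · rw [ContinuousLinearMap.comp_apply, hXw, map_smul, hZw, smul_smul, ← Circle.coe_mul,
      ← phase_add, sub_eq_neg_add]

end Rho

/-! ### Positivity: continuity and null vectors -/

section States

variable {S : Type u} {G : Type v} [AddCommGroup G] [Fintype G]

/-- Positive functionals on a C⋆-algebra are automatically bounded. The spectral order is introduced
only here, to turn nonnegativity on the elements `star y * y` into order positivity. -/
lemma IsState.exists_continuous {ω : quasiLocal S G →ₗ[ℂ] ℂ} (hω : IsState ω) :
    ∃ f : quasiLocal S G →L[ℂ] ℂ, ∀ A, ω A = f A := by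
  have := isClosed_quasiLocal (S := S) (G := G)
  let _ : CStarAlgebra (quasiLocal S G) := StarSubalgebra.cstarAlgebra (quasiLocal S G)
  let _ : PartialOrder (quasiLocal S G) := CStarAlgebra.spectralOrder _
  have _ : StarOrderedRing (quasiLocal S G) := CStarAlgebra.spectralOrderedRing _
  let f : quasiLocal S G →ₚ[ℂ] ℂ := PositiveLinearMap.mk₀ ω fun x hx => by
    obtain ⟨y, rfl⟩ := CStarAlgebra.nonneg_iff_eq_star_mul_self.mp hx
    exact hω.nonneg y
  obtain ⟨C, hC⟩ := f.exists_norm_apply_le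
  exact ⟨LinearMap.mkContinuous ω C hC, fun A => rfl⟩

lemma eq_zero_of_forall_quadratic_nonneg {p s : ℝ} (hp : 0 ≤ p)
    (h : ∀ t : ℝ, 0 ≤ p * t ^ 2 + s * t) : s = 0 := by
  -- The minimiser has denominator `2p`; `p + 1` also covers `p = 0` and still gives a value that is
  -- negative unless `s = 0`.
  have h1 := h (-s / (p + 1))
  have hp1 : 0 < p + 1 := by linarith
  have h2 : p * (-s / (p + 1)) ^ 2 + s * (-s / (p + 1)) = -(s ^ 2 / (p + 1) ^ 2) := by
    field_simp
    ring
  rw [h2] at h1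
  have h3 : s ^ 2 / (p + 1) ^ 2 ≤ 0 := by linarith
  have h4 : s ^ 2 ≤ 0 := by
    by_contra hs
    exact absurd h3 (not_le.mpr (div_pos (not_le.mp hs) (by positivity)))
  exact pow_eq_zero_iff two_ne_zero |>.mp (le_antisymm h4 (sq_nonneg s))

/-- Real and imaginary `c` suffice. It is not assumed that `w` is the conjugate of `z`:
nonnegativity in `ℂ` includes reality, which supplies the two missing equations. -/
lemma eq_zero_of_forall_hermitian_nonneg {p z w : ℂ} (hp : 0 ≤ p)
    (h : ∀ c : ℂ, 0 ≤ star c * c * p + star c * z + c * w) : z = 0 ∧ w = 0 := by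
  obtain ⟨hp0, hp1⟩ := Complex.nonneg_iff.mp hp
  have hre := fun t : ℝ => Complex.nonneg_iff.mp (h t)
  have him := fun t : ℝ => Complex.nonneg_iff.mp (h (t * Complex.I))
  simp [← hp1] at hre him
  have e1 : z.re + w.re = 0 := eq_zero_of_forall_quadratic_nonneg hp0 fun t => by
    have := (hre t).1
    nlinarith
  have e2 : z.im - w.im = 0 := eq_zero_of_forall_quadratic_nonneg hp0 fun t => by
    have := (him t).1
    nlinarith
  have e3 := (hre 1).2
  have e4 := (him 1).2
  constructor <;> refine Complex.ext ?_ ?_ <;> simp <;> linarith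

/-- A null vector of a positive functional is orthogonal to everything. -/
lemma IsState.eq_zero_of_null {ω : quasiLocal S G →ₗ[ℂ] ℂ} (hω : IsState ω)
    {x : quasiLocal S G} (hx : ω (star x * x) = 0) (y : quasiLocal S G) :
    ω (y * x) = 0 ∧ ω (star x * y) = 0 := by
  have key : ∀ v, ω (star v * x) = 0 ∧ ω (star x * v) = 0 := fun v =>
    eq_zero_of_forall_hermitian_nonneg (hω.nonneg v) fun c => by
      -- The constant term of this expansion in `c` is `ω (star x * x) = 0`, leaving a quadratic and
      -- linear terms only.
      have h := hω.nonneg (c • v + x)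
      convert h using 1
      simp only [star_add, star_smul, add_mul, mul_add, smul_mul_assoc, mul_smul_comm, map_add,
        map_smul, smul_eq_mul, hx]
      ring
  exact ⟨by simpa using (key (star y)).1, (key y).2⟩

/-- If the average of the expectations of a finite group of unitaries is `1`, then every one of them
acts trivially in the state. -/
lemma IsState.mul_eq_of_average_eq_one {ω : quasiLocal S G →ₗ[ℂ] ℂ} (hω : IsState ω)
    {ι : Type*} [Fintype ι] [AddGroup ι] (U : ι → quasiLocal S G) (h0 : U 0 = 1)
    (hadd : ∀ i j, U (i + j) = U i * U j) (hstar : ∀ i, star (U i) = U (-i))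
    (hone : ω ((Fintype.card ι : ℂ)⁻¹ • ∑ i, U i) = 1) (i : ι) (A : quasiLocal S G) :
    ω (U i * A) = ω A ∧ ω (A * U i) = ω A := by
  have hcard : (Fintype.card ι : ℂ) ≠ 0 := Nat.cast_ne_zero.mpr Fintype.card_ne_zero
  have hsum : ∑ i, ω (U i) = Fintype.card ι := by
    rw [map_smul, map_sum, smul_eq_mul, inv_mul_eq_one₀ hcard] at hone
    exact hone.symm
  have hexp : ∀ j, star (U j - 1) * (U j - 1) = 1 + 1 - U j - U (-j) := by
    intro j
    have h1 : U (-j) * U j = 1 := by rw [← hadd, neg_add_cancel, h0]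
    rw [star_sub, hstar, star_one, sub_mul, mul_sub, mul_sub, h1]
    simp only [mul_one, one_mul]
    abel
  -- These nonnegative numbers sum to `2|ι| - |ι| - |ι| = 0`, so each of them vanishes.
  have hnull : ∀ j, ω (star (U j - 1) * (U j - 1)) = 0 := by
    have htot : ∑ j, ω (star (U j - 1) * (U j - 1)) = 0 := by
      have hneg : ∑ j, ω (U (-j)) = Fintype.card ι := by
        rw [← hsum]
        exact Equiv.sum_comp (Equiv.neg ι) (fun j => ω (U j))
      simp only [hexp, map_sub, map_add, hω.map_one, Finset.sum_sub_distrib, hsum, hneg]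
      simp
    intro j
    exact (Finset.sum_eq_zero_iff_of_nonneg fun j _ => hω.nonneg (U j - 1)).mp htot j
      (Finset.mem_univ j)
  constructor
  · have h := (hω.eq_zero_of_null (hnull (-i)) A).2
    rw [star_sub, hstar, star_one, neg_neg, sub_mul, one_mul, map_sub] at h
    exact sub_eq_zero.mp h
  · have h := (hω.eq_zero_of_null (hnull i) A).1
    rw [mul_sub, mul_one, map_sub] at h
    exact sub_eq_zero.mp h

end States

/-! ### Existence of stabiliser states -/

section Existence

open Filter

variable {S : Type u} {G : Type v} [AddCommGroup G] [Fintype G]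

/-- A weak limit of a net of vector states. -/
lemma exists_isState_of_vectors {ι : Type*} (l : Filter ι) [l.NeBot] (φ : ι → HilbertSp S G)
    (hφ : ∀ i, ‖φ i‖ = 1) : ∃ ω : quasiLocal S G →ₗ[ℂ] ℂ, IsState ω ∧
      ∀ A c, (∀ᶠ i in l, inner ℂ (φ i) (A.1 (φ i)) = c) → ω A = c := by
  -- Along an ultrafilter all expectations converge at once, since those of `A` stay in the compact
  -- disc of radius `‖A‖`. As it refines `l`, values that are eventually constant along `l` survive.
  let U := Ultrafilter.of l
  have hU : ↑U ≤ l := Ultrafilter.of_le l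
  have hex : ∀ A : quasiLocal S G,
      ∃ z, Tendsto (fun i => inner ℂ (φ i) (A.1 (φ i))) U (𝓝 z) := by
    intro A
    obtain ⟨z, -, hz⟩ := (isCompact_closedBall (0 : ℂ) ‖A.1‖).ultrafilter_le_nhds
      (U.map fun i => inner ℂ (φ i) (A.1 (φ i))) (by
        rw [Ultrafilter.coe_map, le_principal_iff, mem_map]
        refine Eventually.of_forall fun i => ?_
        show inner ℂ (φ i) (A.1 (φ i)) ∈ Metric.closedBall 0 ‖A.1‖
        rw [mem_closedBall_zero_iff]
        refine (norm_inner_le_norm _ _).trans ?_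
        rw [hφ, one_mul]
        simpa [hφ] using A.1.le_opNorm (φ i))
    exact ⟨z, hz⟩
  choose f hf using hex
  have huniq : ∀ A c, (∀ᶠ i in l, inner ℂ (φ i) (A.1 (φ i)) = c) → f A = c := fun A c h =>
    tendsto_nhds_unique (hf A)
      (tendsto_const_nhds.congr' ((h.filter_mono hU).mono fun _ hi => hi.symm))
  refine ⟨
    { toFun := f
      map_add' := fun A B => tendsto_nhds_unique (hf (A + B)) ?_
      map_smul' := fun c A => tendsto_nhds_unique (hf (c • A)) ?_ }, ⟨fun A => ?_, ?_⟩, huniq⟩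
  · refine ((hf A).add (hf B)).congr fun i => ?_
    rw [← inner_add_right]
    rfl
  · refine ((hf A).const_mul c).congr fun i => ?_
    rw [← inner_smul_right]
    rfl
  · refine ge_of_tendsto' (hf (star A * A)) fun i => ?_
    have h : inner ℂ (φ i) ((star A * A).1 (φ i)) = inner ℂ (A.1 (φ i)) (A.1 (φ i)) :=
      ContinuousLinearMap.adjoint_inner_right A.1 (φ i) (A.1 (φ i))
    rw [h, inner_self_eq_norm_sq_to_K]
    exact pow_nonneg (Complex.zero_le_real.mpr (norm_nonneg (A.1 (φ i)))) 2
  · refine huniq 1 1 (Eventually.of_forall fun i => ?_)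
    show inner ℂ (φ i) (φ i) = 1
    rw [inner_self_eq_norm_sq_to_K, hφ]
    simp

/-- The elements of a subgroup of configurations that are supported in a finite set. -/
def supportedIn (H : AddSubgroup (S →₀ G)) (Λ : Finset S) : AddSubgroup (S →₀ G) where
  carrier := {a | a ∈ H ∧ ∀ s ∉ Λ, a s = 0}
  zero_mem' := ⟨zero_mem _, fun _ _ => rfl⟩
  add_mem' := fun ha hb => ⟨add_mem ha.1 hb.1, fun s hs => by simp [ha.2 s hs, hb.2 s hs]⟩
  neg_mem' := fun ha => ⟨neg_mem ha.1, fun s hs => by simp [ha.2 s hs]⟩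

lemma finite_supportedIn (H : AddSubgroup (S →₀ G)) (Λ : Finset S) :
    (supportedIn H Λ : Set (S →₀ G)).Finite := by
  classical
  refine (Set.finite_range (replaceOn Λ (0 : S →₀ G))).subset fun a ha => ⟨fun s => a s, ?_⟩
  ext s
  by_cases hs : s ∈ Λ
  · rw [replaceOn_apply_of_mem _ _ hs]
  · rw [replaceOn_apply_of_notMem _ _ hs, ha.2 s hs, Finsupp.zero_apply]

open Classical in
/-- The sum of the basis vectors `|a⟩` over the elements `a` of `H` supported in `Λ`. -/
def uniformVector (H : AddSubgroup (S →₀ G)) (Λ : Finset S) : HilbertSp S G :=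
  ⟨fun a => if a ∈ supportedIn H Λ then 1 else 0,
    (memℓp_zero ((finite_supportedIn H Λ).subset fun a ha => by
      by_contra h
      exact ha (if_neg h))).of_exponent_ge zero_le⟩

open Classical in
lemma uniformVector_apply (H : AddSubgroup (S →₀ G)) (Λ : Finset S) (a : S →₀ G) :
    uniformVector H Λ a = if a ∈ supportedIn H Λ then 1 else 0 := rfl

lemma uniformVector_ne_zero (H : AddSubgroup (S →₀ G)) (Λ : Finset S) :
    uniformVector H Λ ≠ 0 := by
  intro h
  have h0 : uniformVector H Λ 0 = (0 : HilbertSp S G) 0 := by rw [h]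
  rw [uniformVector_apply, if_pos (zero_mem _)] at h0
  exact one_ne_zero h0

lemma opX_uniformVector {H : AddSubgroup (S →₀ G)} {Λ : Finset S} {a : S →₀ G}
    (ha : a ∈ supportedIn H Λ) : (opX a).1 (uniformVector H Λ) = uniformVector H Λ := by
  refine lp.ext (funext fun h => ?_)
  rw [opX_apply, uniformVector_apply, uniformVector_apply]
  have h2 : h - a ∈ supportedIn H Λ ↔ h ∈ supportedIn H Λ :=
    ⟨fun h' => by simpa using add_mem h' ha, fun h' => sub_mem h' ha⟩
  by_cases hh : h ∈ supportedIn H Λ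
  · rw [if_pos hh, if_pos (h2.mpr hh)]
  · rw [if_neg hh, if_neg fun h' => hh (h2.mp h')]

lemma opZ_uniformVector {H : AddSubgroup (S →₀ G)} (Λ : Finset S) {b : S →₀ CharacterModule G}
    (hb : ∀ a ∈ H, pairChain b a = 0) : (opZ b).1 (uniformVector H Λ) = uniformVector H Λ := by
  refine lp.ext (funext fun h => ?_)
  rw [opZ_apply, uniformVector_apply]
  split_ifs with hh
  · rw [hb h hh.1, phase_zero, Circle.coe_one, one_mul]
  · rw [mul_zero]

/-- A state stabilised by `X^a` for `a` in a subgroup `H` and by `Z^b` for `b` orthogonal to `H`. -/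
lemma exists_isState_of_subgroup (H : AddSubgroup (S →₀ G)) :
    ∃ ω : quasiLocal S G →ₗ[ℂ] ℂ, IsState ω ∧ (∀ a ∈ H, ω (opX a) = 1) ∧
      ∀ b : S →₀ CharacterModule G, (∀ a ∈ H, pairChain b a = 0) → ω (opZ b) = 1 := by
  classical
  set φ : Finset S → HilbertSp S G := fun Λ =>
    ((‖uniformVector H Λ‖ : ℂ))⁻¹ • uniformVector H Λ with hφdef
  have hφ : ∀ Λ, ‖φ Λ‖ = 1 := fun Λ => by
    have h := norm_ne_zero_iff.mpr (uniformVector_ne_zero H Λ)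
    rw [hφdef, norm_smul, norm_inv, Complex.norm_real, norm_norm, inv_mul_cancel₀ h]
  have hfix : ∀ (A : quasiLocal S G) Λ, A.1 (uniformVector H Λ) = uniformVector H Λ →
      inner ℂ (φ Λ) (A.1 (φ Λ)) = 1 := fun A Λ h => by
    have h1 : A.1 (φ Λ) = φ Λ := by rw [hφdef, map_smul, h]
    rw [h1, inner_self_eq_norm_sq_to_K, hφ]
    simp
  obtain ⟨ω, hω, hlim⟩ := exists_isState_of_vectors atTop φ hφ
  refine ⟨ω, hω, fun a ha => hlim _ _ ?_, fun b hb => hlim _ _ (Eventually.of_forall fun Λ =>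
    hfix _ _ (opZ_uniformVector Λ hb))⟩
  -- `Z^b` fixes the vector for every `Λ`, but the shift by `a` preserves the configurations
  -- supported in `Λ` only when `Λ` contains the support of `a`.
  filter_upwards [eventually_ge_atTop a.support] with Λ hΛ
  refine hfix _ _ (opX_uniformVector ⟨ha, fun s hs => ?_⟩)
  exact Finsupp.notMem_support_iff.mp fun h => hs (hΛ h)

end Existence

/-! ### From Weyl expectations to the pairings -/

section Stabilizer

/-- By continuity it is enough to compare on Weyl operators, and where `ω` vanishes the phases are
irrelevant. -/
lemma IsState.comp_rho_eq_of_forall_weyl {S : Type u} {G : Type v} [AddCommGroup G] [Fintype G]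
    {ω : quasiLocal S G →ₗ[ℂ] ℂ} (hω : IsState ω) (γ γ' : S → CharacterModule G) (δ δ' : S → G)
    (h : ∀ p : (S →₀ G) × (S →₀ CharacterModule G), ω (weyl p) ≠ 0 →
      pairLF γ p.1 = pairLF γ' p.1 ∧ pairChain p.2 δ = pairChain p.2 δ') :
    ω ∘ rho γ δ = ω ∘ rho γ' δ' := by
  obtain ⟨R, hR, hRw⟩ := exists_rho_eq γ δ
  obtain ⟨R', hR', hRw'⟩ := exists_rho_eq γ' δ'
  obtain ⟨f, hf⟩ := hω.exists_continuous
  have heq : f.comp R = f.comp R' := eq_of_eq_on_weyl fun p => by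
    rw [ContinuousLinearMap.comp_apply, ContinuousLinearMap.comp_apply, hRw, hRw', ← hf, ← hf,
      map_smul, map_smul]
    by_cases hp : ω (weyl p) = 0
    · rw [hp, smul_zero, smul_zero]
    · rw [(h p hp).1, (h p hp).2]
  funext A
  have hA : f (R A) = f (R' A) := congrArg (fun F : quasiLocal S G →L[ℂ] ℂ => F A) heq
  rw [← hf, ← hf, ← hR, ← hR'] at hA
  exact hA

lemma pairing_eq_of_comp_rho_eq {S : Type u} {G : Type v} [AddCommGroup G] [Fintype G]
    {ω : quasiLocal S G →ₗ[ℂ] ℂ} {γ γ' : S → CharacterModule G} {δ δ' : S → G}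
    (h : ω ∘ rho γ δ = ω ∘ rho γ' δ') {p : (S →₀ G) × (S →₀ CharacterModule G)}
    (hp : ω (weyl p) = 1) :
    pairLF γ p.1 - pairChain p.2 δ = pairLF γ' p.1 - pairChain p.2 δ' := by
  obtain ⟨R, hR, hRw⟩ := exists_rho_eq γ δ
  obtain ⟨R', hR', hRw'⟩ := exists_rho_eq γ' δ'
  have h1 : ω (rho γ δ (weyl p)) = ω (rho γ' δ' (weyl p)) := congrFun h (weyl p)
  rw [hR, hR', hRw, hRw', map_smul, map_smul, hp, smul_eq_mul, smul_eq_mul, mul_one,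
    mul_one] at h1
  exact phase_injective (Circle.ext h1)

variable {S : Type u} {G : Type v} [AddCommGroup G] [Fintype G]

lemma weyl_zero_right (a : S →₀ G) : weyl (a, (0 : S →₀ CharacterModule G)) = opX a := by
  simp [weyl]

lemma weyl_zero_left (b : S →₀ CharacterModule G) : weyl ((0 : S →₀ G), b) = opZ b := by
  simp [weyl]

/-- Weyl operators with nonzero expectation commute with the operators that stabilise the state. -/
lemma pairChain_eq_of_stabilizer {ω : quasiLocal S G →ₗ[ℂ] ℂ}
    {p q : (S →₀ G) × (S →₀ CharacterModule G)}
    (hq : ω (weyl q * weyl p) = ω (weyl p) ∧ ω (weyl p * weyl q) = ω (weyl p))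
    (hp : ω (weyl p) ≠ 0) : pairChain q.2 p.1 = pairChain p.2 q.1 := by
  obtain ⟨h1, h2⟩ := hq
  rw [← h1, weyl_mul_weyl, weyl_mul_weyl, add_comm q p, map_smul, map_smul, smul_eq_mul,
    smul_eq_mul] at h2
  -- Both products are phases times `weyl (p + q)`; a nonzero expectation is needed to cancel it.
  have h3 : ω (weyl (p + q)) ≠ 0 := by
    intro h0
    rw [weyl_mul_weyl, add_comm q p, map_smul, h0, smul_zero] at h1
    exact hp h1.symm
  exact (phase_injective (Circle.ext (mul_right_cancel₀ h3 h2))).symm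

end Stabilizer

/-! ### Frustration-free ground states -/

section GroundStates

variable {E : Type u} [TopologicalSpace E] [T2Space E] [CWComplex (Set.univ : Set E)]
  {o : CellOrientation E} {ho : o.LocallyFinite} {G : Type v} [AddCommGroup G] [Fintype G] {n : ℕ}

lemma isFrustrationFree_of_stabilizers {ω : quasiLocal (Cell E n) G →ₗ[ℂ] ℂ} (hω : IsState ω)
    (hX : ∀ m, m + 1 = n → ∀ (α : Cell E m) (g : G),
      ω (opX (o.coboundarySingle ho m n α g)) = 1)
    (hZ : ∀ (β : Cell E (n + 1)) (χ : CharacterModule G),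
      ω (opZ (o.boundary (n + 1) n (Finsupp.single β χ))) = 1) :
    IsFrustrationFree o ho G n ω := by
  have hG : (Fintype.card G : ℂ) ≠ 0 := Nat.cast_ne_zero.mpr Fintype.card_ne_zero
  refine ⟨hω, fun m hm α => ?_, fun β => ?_⟩
  · simp [starOp, hX m hm, hG]
  · simp [plaquetteOp, hZ, card_characterModule G, hG]

/-- The smallest choice of `H`, generated by the star operators: by adjointness every cycle is
orthogonal to it. For `n = 0` it is trivial, and every chain is a cycle. -/
lemma exists_isFrustrationFree_of_isCycle (ho : o.LocallyFinite) :
    ∃ ω : quasiLocal (Cell E n) G →ₗ[ℂ] ℂ, IsFrustrationFree o ho G n ω ∧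
      ∀ b, o.IsCycle n b → ω (opZ b) = 1 := by
  let T : Set (Cell E n →₀ G) :=
    {a | ∃ m, m + 1 = n ∧ ∃ (α : Cell E m) (g : G), a = o.coboundarySingle ho m n α g}
  have horth : ∀ b : Cell E n →₀ CharacterModule G, (∀ a ∈ T, pairChain b a = 0) →
      ∀ a ∈ AddSubgroup.closure T, pairChain b a = 0 := by
    intro b hb a ha
    induction ha using AddSubgroup.closure_induction with
    | mem x hx => exact hb x hx
    | zero => exact pairChain_zero_right b
    | add x y _ _ hx hy => rw [Finsupp.coe_add, pairChain_add_right, hx, hy, add_zero]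
    | neg x _ hx => rw [Finsupp.coe_neg, pairChain_neg_right, hx, neg_zero]
  obtain ⟨ω, hω, hX, hZ⟩ := exists_isState_of_subgroup (AddSubgroup.closure T)
  refine ⟨ω, isFrustrationFree_of_stabilizers hω (fun m hm α g =>
    hX _ (AddSubgroup.subset_closure ⟨m, hm, α, g, rfl⟩)) (fun β χ => hZ _ (horth _ ?_)),
    fun b hb => hZ b (horth b ?_)⟩
  · rintro _ ⟨m, -, α, g, rfl⟩
    rw [o.pairChain_boundary_single, o.coboundary_coboundarySingle]
    exact map_zero χ
  · rintro _ ⟨m, hm, α, g, rfl⟩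
    rw [o.pairChain_coboundarySingle, hb m hm]
    rfl

/-- The largest choice of `H` that is still orthogonal to the boundaries of the plaquette operators;
it contains the star generators because `∂ᵀ∂ᵀ = 0`. -/
lemma exists_isFrustrationFree_of_isLFCocycle (ho : o.LocallyFinite) :
    ∃ ω : quasiLocal (Cell E n) G →ₗ[ℂ] ℂ, IsFrustrationFree o ho G n ω ∧
      ∀ a, o.IsLFCocycle n a → ω (opX a) = 1 := by
  obtain ⟨ω, hω, hX, hZ⟩ := exists_isState_of_subgroup (o.lfCocycles G n)
  refine ⟨ω, isFrustrationFree_of_stabilizers hω (fun m hm α g => hX _ ?_)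
    (fun β χ => hZ _ fun a ha => ?_), hX⟩
  · exact o.coboundary_coboundarySingle ho m n (n + 1) α g
  · rw [o.pairChain_boundary_single, show o.coboundary n (n + 1) a = 0 from ha]
    exact map_zero χ

variable {ω : quasiLocal (Cell E n) G →ₗ[ℂ] ℂ}

/-- Commuting with the unitaries `X^{∂ᵀ(g e_α)}` makes `p.2` orthogonal to all these coboundaries.
-/
lemma IsFrustrationFree.isCycle (h : IsFrustrationFree o ho G n ω)
    {p : (Cell E n →₀ G) × (Cell E n →₀ CharacterModule G)} (hp : ω (weyl p) ≠ 0) :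
    o.IsCycle n p.2 := by
  intro m hm
  ext α g
  have hstab := h.isState.mul_eq_of_average_eq_one
    (fun g : G => opX (o.coboundarySingle ho m n α g))
    (by rw [show o.coboundarySingle ho m n α (0 : G) = 0 by
          ext; simp [o.coboundarySingle_apply], opX_zero])
    (fun g g' => by rw [o.coboundarySingle_add, opX_add])
    (fun g => by
      rw [star_opX]
      congr 1
      ext
      simp [o.coboundarySingle_apply])
    (h.star_eq_one m hm α) g (weyl p)
  simp only [← weyl_zero_right] at hstab
  have h1 := pairChain_eq_of_stabilizer hstab hp
  rw [← o.pairChain_coboundarySingle ho, ← h1]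
  rfl

lemma IsFrustrationFree.isLFCocycle (h : IsFrustrationFree o ho G n ω)
    {p : (Cell E n →₀ G) × (Cell E n →₀ CharacterModule G)} (hp : ω (weyl p) ≠ 0) :
    o.IsLFCocycle n p.1 := by
  refine funext fun β => ?_
  by_contra hne
  obtain ⟨χ, hχ⟩ := CharacterModule.exists_character_apply_ne_zero_of_ne_zero hne
  have hstab := h.isState.mul_eq_of_average_eq_one
    (fun χ : CharacterModule G => opZ (o.boundary (n + 1) n (Finsupp.single β χ)))
    (by rw [Finsupp.single_zero, show o.boundary (n + 1) n (0 : _ →₀ CharacterModule G) = 0 from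
          rfl, opZ_zero])
    (fun χ ψ => by rw [o.boundary_single_add, opZ_add])
    (fun χ => by
      rw [star_opZ]
      congr 1
      simp only [o.boundary_single]
      ext
      simp)
    -- The average runs over the dual group but is normalised by `|G|`; the two orders agree.
    (by rw [card_characterModule G]; exact h.plaquette_eq_one β) χ (weyl p)
  simp only [← weyl_zero_left] at hstab
  have h1 := pairChain_eq_of_stabilizer hstab hp
  rw [o.pairChain_boundary_single] at h1
  exact hχ (h1.trans (pairChain_zero_right p.2))

end GroundStates

end CellModel

end

/-! ### The equivalence -/

theorem proposition7 {E : Type u} [TopologicalSpace E] [T2Space E]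
    [CWComplex (Set.univ : Set E)] (o : CellModel.CellOrientation E) (ho : o.LocallyFinite)
    (G : Type v) [AddCommGroup G] [Fintype G] (n : ℕ)
    (γ γ' : CellModel.Cell E n → CharacterModule G) (δ δ' : CellModel.Cell E n → G) :
    ((∀ b : CellModel.Cell E n →₀ CharacterModule G, o.IsCycle n b →
        CellModel.pairChain b (δ' - δ) = 0) ∧
      (∀ a : CellModel.Cell E n →₀ G, o.IsLFCocycle n a →
        CellModel.pairLF (γ' - γ) a = 0)) ↔
    ∀ ω : CellModel.quasiLocal (CellModel.Cell E n) G →ₗ[ℂ] ℂ,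
      CellModel.IsFrustrationFree o ho G n ω →
        ω ∘ CellModel.rho γ δ = ω ∘ CellModel.rho γ' δ' := by
  constructor
  · rintro ⟨hb, ha⟩ ω hω
    refine hω.isState.comp_rho_eq_of_forall_weyl γ γ' δ δ' fun p hp => ?_
    have h1 := hb _ (hω.isCycle hp)
    have h2 := ha _ (hω.isLFCocycle hp)
    rw [CellModel.pairChain_sub_right, sub_eq_zero] at h1
    rw [CellModel.pairLF_sub_left, sub_eq_zero] at h2
    exact ⟨h2.symm, h1.symm⟩
  · intro h
    constructor
    · intro b hb
      obtain ⟨ω, hω, hZ⟩ := CellModel.exists_isFrustrationFree_of_isCycle (G := G) (n := n) ho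
      have h1 := CellModel.pairing_eq_of_comp_rho_eq (h ω hω) (p := (0, b))
        (by rw [CellModel.weyl_zero_left, hZ b hb])
      rw [CellModel.pairChain_sub_right, sub_eq_zero]
      -- Conjugation by `X^δ` contributes `-⟨b,δ⟩` to the phase, hence the negation.
      exact (neg_injective (by simpa [CellModel.pairLF] using h1)).symm
    · intro a ha
      obtain ⟨ω, hω, hX⟩ := CellModel.exists_isFrustrationFree_of_isLFCocycle (G := G) (n := n) ho
      have h1 := CellModel.pairing_eq_of_comp_rho_eq (h ω hω) (p := (a, 0))
        (by rw [CellModel.weyl_zero_right, hX a ha])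
      rw [CellModel.pairLF_sub_left, sub_eq_zero]
      exact (by simpa using h1 : CellModel.pairLF γ a = CellModel.pairLF γ' a).symm
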